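/- Let $d=-A^2-A^{-2}$ and $\mathcal R=\mathbb Z[A^{\pm1},d^{-1}]$. A ribbon $2$-graph diagram is a planar diagram in $\mathbb R\times[0,1]$, with two endpoints on the top line and two on the bottom line, made of finitely many strands (closed circles, arcs joining two endpoints, half edges joining an endpoint to a vertex, and ordinary edges joining vertices), vertices of arbitrary valency, and crossings with over/under information; diagrams are considered up to planar isotopy and the extended Reidemeister moves for (blackboard framed) ribbon graphs. Let $\mathcal Y_2$ be the quotient of the free $\mathcal R$-module on these diagrams by the Yamada skein relations, in each of which the diagrams agree outside a small disk: 1. a crossing equals $A^{4}D_0+A^{-4}D_\infty-d\,D_\times$, where $D_0$ and $D_\infty$ are its $A$- and $A^{-1}$-smoothings (in the sense of the Kauffman bracket relation $L=A\,L_0+A^{-1}L_\infty$) and in $D_\times$ the crossing is replaced by a four-valent vertex; 2. $G=G/e-d^{-1}(G-e)$ for an edge $e$ joining two distinct vertices, where $G/e$ is contraction and $G-e$ deletion of $e$; 3. a loop at a vertex (a loop without crossings that encloses nothing) may be removed at the cost of the factor $d-d^{-1}$; 4. a circle (without crossings, enclosing nothing) may be removed at the cost of the factor $d^2-1$; 5.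 a two-valent vertex may be erased (it is an ordinary point of a strand), and an isolated vertex may be removed at the cost of the factor $d$. $\mathcal Y_2$ is an $\mathcal R$-algebra in which $GG'$ is $G$ placed over $G'$. Its unit $1_2$ is the class of two parallel vertical strands. Let $V$ be the class of the diagram consisting of an arc joining the two upper endpoints and an arc joining the two lower endpoints, and let $X$ be the class of the diagram consisting of one four-valent vertex joined to the four endpoints by half edges. Theorem 1.1. $\mathcal Y_2$ is a free $\mathcal R$-module with basis $1_2, V, X$; that is, these three elements are linearly independent over $\mathcal R$ and generate $\mathcal Y_2$ as an $\mathcal R$-module, hence also as an $\mathcal R$-algebra. -/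

import Mathlib

/-! ## The coefficient ring `ℤ[A, A⁻¹, d⁻¹]`, `d = -A² - A⁻²` -/

open scoped LaurentPolynomial in
/-- The Laurent polynomial `-A² - A⁻²`, where `A` is the variable. -/
noncomputable def laurentD : ℤ[T;T⁻¹] :=
  -LaurentPolynomial.T 2 - LaurentPolynomial.T (-2)

/-- The ring `ℤ[A, A⁻¹, d⁻¹]`. -/
abbrev SkeinRing : Type := Localization.Away laurentD

/-- `A ^ k` in the coefficient ring, for an integer exponent `k`. -/
noncomputable def SkeinRing.Apow (k : ℤ) : SkeinRing :=
  algebraMap (LaurentPolynomial ℤ) SkeinRing (LaurentPolynomial.T k)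

/-- The element `d = -A² - A⁻²`. -/
noncomputable def SkeinRing.d : SkeinRing := algebraMap _ _ laurentD

/-- The element `d⁻¹`. -/
noncomputable def SkeinRing.dInv : SkeinRing := IsLocalization.Away.invSelf laurentD

/-! ## Diagrams in the strip

A generic planar diagram in `ℝ × [0, 1]` is cut by horizontal lines into layers, each of which
contains one elementary piece with vertical strands on both sides of it. It is read from top to
bottom. -/

/-- The elementary pieces of a diagram. Vertices (the coupons of the ribbon graph) may have any
number of legs. The surface is recovered by thickening in the plane (blackboard framing). -/
inductive Piece : Type
  /-- A local maximum `∩`. -/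
  | cap
  /-- A local minimum `∪`. -/
  | cup
  /-- A crossing: `crossing false` has the strand from bottom left to top right on top, and
  `crossing true` has the strand from top left to bottom right on top. -/
  | crossing (s : Bool)
  /-- A vertex with `p` legs going up and `q` legs going down. -/
  | vertex (p q : ℕ)

/-- Number of strands leaving the piece at its top. -/
def Piece.top : Piece → ℕ
  | .cap => 0
  | .cup => 2
  | .crossing _ => 2
  | .vertex p _ => p

/-- Number of strands leaving the piece at its bottom. -/
def Piece.bot : Piece → ℕ
  | .cap => 2
  | .cup => 0
  | .crossing _ => 2
  | .vertex _ q => q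

/-- A layer: a piece with `left` vertical strands on its left (the number of strands on its right
is then determined by the total number of strands). -/
structure Layer : Type where
  left : ℕ
  piece : Piece

/-- `IsDiagram n w m`: the layers of `w`, stacked from top to bottom, fit together to a diagram
with `n` endpoints at the top and `m` endpoints at the bottom. -/
inductive IsDiagram : ℕ → List Layer → ℕ → Prop
  | nil (n : ℕ) : IsDiagram n [] n
  | cons (a b : ℕ) (p : Piece) (w : List Layer) (m : ℕ) (h : IsDiagram (a + p.bot + b) w m) :
      IsDiagram (a + p.top + b) (⟨a, p⟩ :: w) m

theorem IsDiagram.append {n m k : ℕ} {w w' : List Layer} (h : IsDiagram n w m)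
    (h' : IsDiagram m w' k) : IsDiagram n (w ++ w') k := by
  induction h with
  | nil n => exact h'
  | cons a b p w m h ih => exact .cons a b p _ _ (ih h')

/-- Diagrams with `n` endpoints at the top and `m` endpoints at the bottom. -/
def Diagram (n m : ℕ) : Type := {w : List Layer // IsDiagram n w m}

/-- `D` placed over `D'`. -/
def Diagram.comp {n m k : ℕ} (D : Diagram n m) (D' : Diagram m k) : Diagram n k :=
  ⟨D.1 ++ D'.1, D.2.append D'.2⟩

/-- The elementary planar isotopies. -/
inductive PlanarMove : List Layer → List Layer → Prop
  /-- Two pieces at different places, `c` strands apart, may be moved past each other's height. -/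
  | exchange (a c : ℕ) (p q : Piece) :
      PlanarMove [⟨a, p⟩, ⟨a + p.bot + c, q⟩] [⟨a + p.top + c, q⟩, ⟨a, p⟩]
  /-- Straightening a bend. -/
  | zigzag_left (a : ℕ) : PlanarMove [⟨a + 1, .cap⟩, ⟨a, .cup⟩] []
  | zigzag_right (a : ℕ) : PlanarMove [⟨a, .cap⟩, ⟨a + 1, .cup⟩] []
  /-- A quarter turn of a crossing. -/
  | turn_crossing (a : ℕ) (s : Bool) :
      PlanarMove [⟨a, .cap⟩, ⟨a + 1, .crossing s⟩, ⟨a + 2, .cup⟩] [⟨a, .crossing !s⟩]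
  /-- Vertices are round: the leftmost upper leg, bent down, is the leftmost lower leg. -/
  | turn_vertex_left (a p q : ℕ) :
      PlanarMove [⟨a, .cap⟩, ⟨a + 1, .vertex (p + 1) q⟩] [⟨a, .vertex p (q + 1)⟩]
  /-- The same for the rightmost leg. -/
  | turn_vertex_right (a p q : ℕ) :
      PlanarMove [⟨a + p, .cap⟩, ⟨a, .vertex (p + 1) q⟩] [⟨a, .vertex p (q + 1)⟩]

/-- The extended Reidemeister moves for ribbon graph diagrams. -/
inductive ReidemeisterMove : List Layer → List Layer → Prop
  /-- Two curls on opposite sides of a strand, with the same writhe. -/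
  | curl (a : ℕ) (s : Bool) :
      ReidemeisterMove [⟨a + 1, .cap⟩, ⟨a, .crossing s⟩, ⟨a + 1, .cup⟩]
        [⟨a, .cap⟩, ⟨a + 1, .crossing s⟩, ⟨a, .cup⟩]
  /-- The second move. -/
  | cancel (a : ℕ) (s : Bool) :
      ReidemeisterMove [⟨a, .crossing s⟩, ⟨a, .crossing !s⟩] []
  /-- The third move. -/
  | braid (a : ℕ) (s : Bool) :
      ReidemeisterMove [⟨a, .crossing s⟩, ⟨a + 1, .crossing s⟩, ⟨a, .crossing s⟩]
        [⟨a + 1, .crossing s⟩, ⟨a, .crossing s⟩, ⟨a + 1, .crossing s⟩]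
  /-- A strand passes over, or under, a vertex with `k` legs. -/
  | slide (a k : ℕ) (s : Bool) :
      ReidemeisterMove [⟨a + 1, .vertex 0 k⟩]
        (⟨a, .vertex 0 k⟩ :: (List.range k).reverse.map fun i => ⟨a + i, .crossing s⟩)

/-- `D'` arises from `D` by one move, inside an otherwise unchanged diagram. -/
def IsotopyStep {n m : ℕ} (D D' : Diagram n m) : Prop :=
  ∃ u w w' v : List Layer, (PlanarMove w w' ∨ ReidemeisterMove w w') ∧
    D.1 = u ++ w ++ v ∧ D'.1 = u ++ w' ++ v

/-- Ribbon `n`-graphs: diagrams with `n` endpoints at the top and `n` at the bottom, up to the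
equivalence relation generated by planar isotopies and extended Reidemeister moves. -/
def RibbonGraph (n : ℕ) : Type := Quot (IsotopyStep (n := n) (m := n))

namespace RibbonGraph

/-- The ribbon graph of a diagram. -/
def mk {n : ℕ} (D : Diagram n n) : RibbonGraph n := Quot.mk _ D

/-- `G * G'` is `G` put over `G'`; the unit consists of `n` parallel vertical strands. -/
instance (n : ℕ) : Monoid (RibbonGraph n) where
  mul := Quot.map₂ Diagram.comp
    (by
      rintro D E E' ⟨u, w, w', v, h, h1, h2⟩
      exact ⟨D.1 ++ u, w, w', v, h, by simp [Diagram.comp, h1], by simp [Diagram.comp, h2]⟩)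
    (by
      rintro D D' E ⟨u, w, w', v, h, h1, h2⟩
      exact ⟨u, w, w', v ++ E.1, h, by simp [Diagram.comp, h1], by simp [Diagram.comp, h2]⟩)
  one := mk ⟨[], .nil n⟩
  mul_assoc := by
    rintro ⟨D⟩ ⟨E⟩ ⟨F⟩
    exact congrArg mk (Subtype.ext (List.append_assoc _ _ _))
  one_mul := by
    rintro ⟨D⟩
    rfl
  mul_one := by
    rintro ⟨D⟩
    exact congrArg mk (Subtype.ext (List.append_nil _))

theorem mk_mul_mk {n : ℕ} (D E : Diagram n n) : mk D * mk E = mk (D.comp E) := rfl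

end RibbonGraph

/-! ## The Yamada skein relations -/

/-- A ribbon graph diagram as an element of the free module on ribbon graphs. -/
noncomputable def Diagram.elt {n : ℕ} (D : Diagram n n) :
    MonoidAlgebra SkeinRing (RibbonGraph n) :=
  MonoidAlgebra.of SkeinRing (RibbonGraph n) (RibbonGraph.mk D)

open SkeinRing in
/-- The Yamada skein relators. In each of them the diagrams are identical (`u` above, `v` below)
except in a small disk, whose content is shown in the hypotheses. -/
inductive YamadaRelator (n : ℕ) : MonoidAlgebra SkeinRing (RibbonGraph n) → Prop
  /-- A crossing is `A⁴` times the vertical smoothing plus `A⁻⁴` times the horizontal smoothing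
  minus `d` times the four-valent vertex. -/
  | crossing (u v : List Layer) (a : ℕ) (D D₀ D₁ D₂ : Diagram n n)
      (h : D.1 = u ++ [⟨a, .crossing false⟩] ++ v)
      (h₀ : D₀.1 = u ++ v)
      (h₁ : D₁.1 = u ++ [⟨a, .cup⟩, ⟨a, .cap⟩] ++ v)
      (h₂ : D₂.1 = u ++ [⟨a, .vertex 2 2⟩] ++ v) :
      YamadaRelator n
        (D.elt - (Apow 4 • D₀.elt + Apow (-4) • D₁.elt - d • D₂.elt))
  /-- Contraction and deletion of an edge joining two distinct vertices, which have `p` and `q`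
  further legs. -/
  | edge (u v : List Layer) (a p q : ℕ) (D D₀ D₁ : Diagram n n)
      (h : D.1 = u ++ [⟨a, .vertex p 1⟩, ⟨a, .vertex 1 q⟩] ++ v)
      (h₀ : D₀.1 = u ++ [⟨a, .vertex p q⟩] ++ v)
      (h₁ : D₁.1 = u ++ [⟨a, .vertex p 0⟩, ⟨a, .vertex 0 q⟩] ++ v) :
      YamadaRelator n (D.elt - (D₀.elt - dInv • D₁.elt))
  /-- Removal of a loop at a vertex with `p` further legs. -/
  | loop (u v : List Layer) (a p : ℕ) (D D₀ : Diagram n n)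
      (h : D.1 = u ++ [⟨a, .vertex p 2⟩, ⟨a, .cup⟩] ++ v)
      (h₀ : D₀.1 = u ++ [⟨a, .vertex p 0⟩] ++ v) :
      YamadaRelator n (D.elt - (d - dInv) • D₀.elt)
  /-- Removal of a circle. -/
  | circle (u v : List Layer) (a : ℕ) (D D₀ : Diagram n n)
      (h : D.1 = u ++ [⟨a, .cap⟩, ⟨a, .cup⟩] ++ v)
      (h₀ : D₀.1 = u ++ v) :
      YamadaRelator n (D.elt - (d ^ 2 - 1) • D₀.elt)
  /-- A two-valent vertex is an ordinary point of a strand. -/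
  | bivalent (u v : List Layer) (a : ℕ) (D D₀ : Diagram n n)
      (h : D.1 = u ++ [⟨a, .vertex 1 1⟩] ++ v)
      (h₀ : D₀.1 = u ++ v) :
      YamadaRelator n (D.elt - D₀.elt)
  /-- Removal of an isolated vertex. -/
  | isolated (u v : List Layer) (a : ℕ) (D D₀ : Diagram n n)
      (h : D.1 = u ++ [⟨a, .vertex 0 0⟩] ++ v)
      (h₀ : D₀.1 = u ++ v) :
      YamadaRelator n (D.elt - d • D₀.elt)

/-- The smallest submodule containing all Yamada skein relators. -/
noncomputable def yamadaSubmodule (n : ℕ) :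
    Submodule SkeinRing (MonoidAlgebra SkeinRing (RibbonGraph n)) :=
  Submodule.span SkeinRing {x | YamadaRelator n x}

theorem Diagram.elt_mul {n : ℕ} (D E : Diagram n n) : D.elt * E.elt = (D.comp E).elt :=
  (map_mul (MonoidAlgebra.of SkeinRing (RibbonGraph n)) _ _).symm

theorem YamadaRelator.mul_left {n : ℕ} (E : Diagram n n)
    {x : MonoidAlgebra SkeinRing (RibbonGraph n)} (hx : YamadaRelator n x) :
    YamadaRelator n (E.elt * x) := by
  cases hx with
  | crossing u v a D D₀ D₁ D₂ h h₀ h₁ h₂ =>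
    simp only [mul_sub, mul_add, mul_smul_comm, Diagram.elt_mul]
    exact .crossing (E.1 ++ u) v a _ _ _ _ (by simp [Diagram.comp, h])
      (by simp [Diagram.comp, h₀]) (by simp [Diagram.comp, h₁]) (by simp [Diagram.comp, h₂])
  | edge u v a p q D D₀ D₁ h h₀ h₁ =>
    simp only [mul_sub, mul_smul_comm, Diagram.elt_mul]
    exact .edge (E.1 ++ u) v a p q _ _ _ (by simp [Diagram.comp, h])
      (by simp [Diagram.comp, h₀]) (by simp [Diagram.comp, h₁])
  | loop u v a p D D₀ h h₀ =>
    simp only [mul_sub, mul_smul_comm, Diagram.elt_mul]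
    exact .loop (E.1 ++ u) v a p _ _ (by simp [Diagram.comp, h]) (by simp [Diagram.comp, h₀])
  | circle u v a D D₀ h h₀ =>
    simp only [mul_sub, mul_smul_comm, Diagram.elt_mul]
    exact .circle (E.1 ++ u) v a _ _ (by simp [Diagram.comp, h]) (by simp [Diagram.comp, h₀])
  | bivalent u v a D D₀ h h₀ =>
    simp only [mul_sub, Diagram.elt_mul]
    exact .bivalent (E.1 ++ u) v a _ _ (by simp [Diagram.comp, h]) (by simp [Diagram.comp, h₀])
  | isolated u v a D D₀ h h₀ =>
    simp only [mul_sub, mul_smul_comm, Diagram.elt_mul]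
    exact .isolated (E.1 ++ u) v a _ _ (by simp [Diagram.comp, h]) (by simp [Diagram.comp, h₀])

theorem YamadaRelator.mul_right {n : ℕ} (E : Diagram n n)
    {x : MonoidAlgebra SkeinRing (RibbonGraph n)} (hx : YamadaRelator n x) :
    YamadaRelator n (x * E.elt) := by
  cases hx with
  | crossing u v a D D₀ D₁ D₂ h h₀ h₁ h₂ =>
    simp only [sub_mul, add_mul, smul_mul_assoc, Diagram.elt_mul]
    exact .crossing u (v ++ E.1) a _ _ _ _ (by simp [Diagram.comp, h])
      (by simp [Diagram.comp, h₀]) (by simp [Diagram.comp, h₁]) (by simp [Diagram.comp, h₂])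
  | edge u v a p q D D₀ D₁ h h₀ h₁ =>
    simp only [sub_mul, smul_mul_assoc, Diagram.elt_mul]
    exact .edge u (v ++ E.1) a p q _ _ _ (by simp [Diagram.comp, h])
      (by simp [Diagram.comp, h₀]) (by simp [Diagram.comp, h₁])
  | loop u v a p D D₀ h h₀ =>
    rw [sub_mul, smul_mul_assoc, Diagram.elt_mul, Diagram.elt_mul]
    exact .loop u (v ++ E.1) a p _ _ (by simp [Diagram.comp, h]) (by simp [Diagram.comp, h₀])
  | circle u v a D D₀ h h₀ =>
    rw [sub_mul, smul_mul_assoc, Diagram.elt_mul, Diagram.elt_mul]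
    exact .circle u (v ++ E.1) a _ _ (by simp [Diagram.comp, h]) (by simp [Diagram.comp, h₀])
  | bivalent u v a D D₀ h h₀ =>
    rw [sub_mul, Diagram.elt_mul, Diagram.elt_mul]
    exact .bivalent u (v ++ E.1) a _ _ (by simp [Diagram.comp, h]) (by simp [Diagram.comp, h₀])
  | isolated u v a D D₀ h h₀ =>
    rw [sub_mul, smul_mul_assoc, Diagram.elt_mul, Diagram.elt_mul]
    exact .isolated u (v ++ E.1) a _ _ (by simp [Diagram.comp, h]) (by simp [Diagram.comp, h₀])

theorem yamadaSubmodule_mul_left (n : ℕ) (y : MonoidAlgebra SkeinRing (RibbonGraph n))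
    {x : MonoidAlgebra SkeinRing (RibbonGraph n)} (hx : x ∈ yamadaSubmodule n) :
    y * x ∈ yamadaSubmodule n := by
  induction y using MonoidAlgebra.induction_on with
  | of g =>
    obtain ⟨E⟩ := g
    induction hx using Submodule.span_induction with
    | mem x h => exact Submodule.subset_span (h.mul_left E)
    | zero => rw [mul_zero]; exact zero_mem _
    | add x z _ _ h1 h2 => rw [mul_add]; exact add_mem h1 h2
    | smul c x _ h => rw [mul_smul_comm]; exact Submodule.smul_mem _ _ h
  | add f g hf hg => rw [add_mul]; exact add_mem hf hg
  | smul r f hf => rw [smul_mul_assoc]; exact Submodule.smul_mem _ _ hf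

theorem yamadaSubmodule_mul_right (n : ℕ) (y : MonoidAlgebra SkeinRing (RibbonGraph n))
    {x : MonoidAlgebra SkeinRing (RibbonGraph n)} (hx : x ∈ yamadaSubmodule n) :
    x * y ∈ yamadaSubmodule n := by
  induction y using MonoidAlgebra.induction_on with
  | of g =>
    obtain ⟨E⟩ := g
    induction hx using Submodule.span_induction with
    | mem x h => exact Submodule.subset_span (h.mul_right E)
    | zero => rw [zero_mul]; exact zero_mem _
    | add x z _ _ h1 h2 => rw [add_mul]; exact add_mem h1 h2
    | smul c x _ h => rw [smul_mul_assoc]; exact Submodule.smul_mem _ _ h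
  | add f g hf hg => rw [mul_add]; exact add_mem hf hg
  | smul r f hf => rw [mul_smul_comm]; exact Submodule.smul_mem _ _ hf

/-- The submodule `yamadaSubmodule n`, seen as an ideal of the algebra of ribbon graphs. -/
noncomputable def yamadaIdeal (n : ℕ) : Ideal (MonoidAlgebra SkeinRing (RibbonGraph n)) where
  carrier := yamadaSubmodule n
  add_mem' := fun h h' => add_mem h h'
  zero_mem' := zero_mem _
  smul_mem' := fun y _ hx => yamadaSubmodule_mul_left n y hx

instance (n : ℕ) : (yamadaIdeal n).IsTwoSided :=
  ⟨fun y hx => yamadaSubmodule_mul_right n y hx⟩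

/-- The graph algebra `𝒴ₙ`: the free module on ribbon `n`-graphs modulo the Yamada skein
relations. -/
abbrev YamadaAlgebra (n : ℕ) : Type :=
  MonoidAlgebra SkeinRing (RibbonGraph n) ⧸ yamadaIdeal n

/-- The class of a diagram in the graph algebra. -/
noncomputable def Diagram.skein {n : ℕ} (D : Diagram n n) : YamadaAlgebra n :=
  Ideal.Quotient.mk (yamadaIdeal n) D.elt

/-- The diagram of `V`: a `∪` joining the two upper endpoints over a `∩` joining the two lower
endpoints. -/
def diagramV : Diagram 2 2 :=
  ⟨[⟨0, .cup⟩, ⟨0, .cap⟩], .cons 0 0 .cup _ _ (.cons 0 0 .cap _ _ (.nil 2))⟩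

/-- The diagram of `X`: a four-valent vertex joined to the four endpoints. -/
def diagramX : Diagram 2 2 :=
  ⟨[⟨0, .vertex 2 2⟩], .cons 0 0 (.vertex 2 2) _ _ (.nil 2)⟩

/-!
The three elements span because vertices absorb everything. The two upper endpoints of a diagram are
bent down, so that it becomes a diagram without upper endpoints. Crossings are resolved by the first
skein relation, and a vertex with upper legs is a vertex without upper legs followed by local minima.
If a local minimum is attached to vertices without upper legs, it closes a loop at one of them
(`wordClass_loop_between`), or it joins two of them by an edge, which is then contracted and deleted
(`wordClass_edge_between`). Hence a diagram without upper endpoints is a linear combination of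
noncrossing partitions of its lower endpoints (`IsDiagram.reducible`). Blocks with one element
vanish, so that `{1,2,3,4}`, `{1,2},{3,4}` and `{1,4},{2,3}` remain for four endpoints: these are `X`,
`V` and `1`.

The three elements are linearly independent because of a state sum. The planar part of the skein
relations is that of the chromatic polynomial of the dual graph: colour the regions of a diagram
with `N = d²` colours such that regions on both sides of a strand have different colours. For an edge
`e`, the colourings for `G/e` are those for `G` and those in which both sides of `e` have the same
colour, which are the colourings for `G - e`. With a factor `d¹⁻ᵠ` for a vertex with `q` lower legs
this is the second relation. By the first relation a crossing between regions coloured `l`, `t`,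
`b`, `r` has the weight `A⁴ [t = b] + A⁻⁴ [l = r] - 1`. These weights form a flat connection
(`ColourWeights.sum_transport_mul_transport`): if a strand is drawn across other strands, the
amplitudes for the two sides of the strand compose, whatever the intermediate colours on one
side are. All Reidemeister moves follow from it. The matrix entries of `1`, `V`, `X` in this model
show that the coefficients of a linear relation vanish for every real `A` for which `d²` is an integer
`N ≥ 5`. These are infinitely many values of `A`, so the coefficients are zero.
-/

/-! ### Typing of words -/

theorem isDiagram_nil_iff {n m : ℕ} : IsDiagram n [] m ↔ n = m :=
  ⟨fun h => by cases h; rfl, fun h => h ▸ .nil n⟩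

theorem isDiagram_cons_iff {n m a : ℕ} {p : Piece} {w : List Layer} :
    IsDiagram n (⟨a, p⟩ :: w) m ↔ a + p.top ≤ n ∧ IsDiagram (n - p.top + p.bot) w m := by
  constructor
  · rintro (_ | ⟨_, b, _, _, _, h⟩)
    exact ⟨by omega, by convert h using 1; omega⟩
  · rintro ⟨h₁, h₂⟩
    have := IsDiagram.cons a (n - p.top - a) p w m (by convert h₂ using 1; omega)
    convert this using 1
    omega

theorem isDiagram_append_iff {n m : ℕ} {u v : List Layer} :
    IsDiagram n (u ++ v) m ↔ ∃ k, IsDiagram n u k ∧ IsDiagram k v m := by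
  induction u generalizing n with
  | nil => simp [isDiagram_nil_iff]
  | cons l u ih =>
    obtain ⟨a, p⟩ := l
    simp only [List.cons_append, isDiagram_cons_iff, ih, and_assoc, exists_and_left]

theorem IsDiagram.cast {n n' m : ℕ} {w : List Layer} (h : IsDiagram n w m) (hn : n = n') :
    IsDiagram n' w m := hn ▸ h

theorem IsDiagram.cast_bot {n m m' : ℕ} {w : List Layer} (h : IsDiagram n w m) (hm : m = m') :
    IsDiagram n w m' := hm ▸ h

theorem IsDiagram.unique {n m m' : ℕ} {w : List Layer} (h : IsDiagram n w m)
    (h' : IsDiagram n w m') : m = m' := by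
  induction w generalizing n with
  | nil => rw [isDiagram_nil_iff] at h h'; omega
  | cons l w ih =>
    obtain ⟨a, p⟩ := l
    rw [isDiagram_cons_iff] at h h'
    exact ih h.2 h'.2

/-- Additional vertical strands on the right of a diagram do not change its word. -/
theorem IsDiagram.pad {n m : ℕ} {w : List Layer} (h : IsDiagram n w m) (c : ℕ) :
    IsDiagram (n + c) w (m + c) := by
  induction h with
  | nil n => exact .nil _
  | cons a b p w m h ih =>
    rw [isDiagram_cons_iff]
    exact ⟨by omega, ih.cast (by omega)⟩

/-! ### Classes of words in the graph algebra -/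

open Classical in
/-- The class in `𝒴₂` of a word of layers, with the value `0` for words that are not diagrams from
two endpoints to two endpoints. -/
noncomputable def wordClass (w : List Layer) : YamadaAlgebra 2 :=
  if h : IsDiagram 2 w 2 then Diagram.skein ⟨w, h⟩ else 0

theorem wordClass_eq {w : List Layer} (h : IsDiagram 2 w 2) :
    wordClass w = Diagram.skein ⟨w, h⟩ := dif_pos h

/-- Words `w` and `w'` from `n` to `m` endpoints that represent the same class in every diagram of
`𝒴₂` of which they are a part. -/
def SameSkein (n m : ℕ) (w w' : List Layer) : Prop :=
  IsDiagram n w m ∧ IsDiagram n w' m ∧ ∀ u v, IsDiagram 2 u n → IsDiagram m v 2 →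
    wordClass (u ++ w ++ v) = wordClass (u ++ w' ++ v)

namespace SameSkein

theorem refl {n m : ℕ} {w : List Layer} (h : IsDiagram n w m) : SameSkein n m w w :=
  ⟨h, h, fun _ _ _ _ => rfl⟩

theorem symm {n m : ℕ} {w w' : List Layer} (h : SameSkein n m w w') : SameSkein n m w' w :=
  ⟨h.2.1, h.1, fun u v hu hv => (h.2.2 u v hu hv).symm⟩

theorem trans {n m : ℕ} {w w' w'' : List Layer} (h : SameSkein n m w w')
    (h' : SameSkein n m w' w'') : SameSkein n m w w'' :=
  ⟨h.1, h'.2.1, fun u v hu hv => (h.2.2 u v hu hv).trans (h'.2.2 u v hu hv)⟩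

theorem append_left {k n m : ℕ} {w w' : List Layer} (u : List Layer) (h : SameSkein n m w w')
    (hu : IsDiagram k u n) : SameSkein k m (u ++ w) (u ++ w') :=
  ⟨hu.append h.1, hu.append h.2.1, fun x y hx hy => by
    simpa using h.2.2 (x ++ u) y (hx.append hu) hy⟩

theorem append_right {k n m : ℕ} {w w' : List Layer} (v : List Layer) (h : SameSkein n m w w')
    (hv : IsDiagram m v k) : SameSkein n k (w ++ v) (w' ++ v) :=
  ⟨h.1.append hv, h.2.1.append hv, fun x y hx hy => by
    simpa using h.2.2 x (v ++ y) hx (hv.append hy)⟩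

theorem of_move {n m : ℕ} {w w' : List Layer} (h : PlanarMove w w' ∨ ReidemeisterMove w w')
    (hw : IsDiagram n w m) (hw' : IsDiagram n w' m) : SameSkein n m w w' := by
  refine ⟨hw, hw', fun u v hu hv => ?_⟩
  rw [wordClass_eq ((hu.append hw).append hv), wordClass_eq ((hu.append hw').append hv)]
  refine congrArg (fun g => Ideal.Quotient.mk (yamadaIdeal 2)
    (MonoidAlgebra.of SkeinRing (RibbonGraph 2) g)) (Quot.sound ?_)
  exact ⟨u, w, w', v, h, rfl, rfl⟩

theorem exchange {n m : ℕ} (a c b : ℕ) (p q : Piece) (hn : n = a + p.top + c + q.top + b)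
    (hm : m = a + p.bot + c + q.bot + b) :
    SameSkein n m [⟨a, p⟩, ⟨a + p.bot + c, q⟩] [⟨a + p.top + c, q⟩, ⟨a, p⟩] := by
  refine of_move (.inl (.exchange a c p q)) ?_ ?_ <;>
    simp only [isDiagram_cons_iff, isDiagram_nil_iff] <;> omega

theorem exchange_of_eq {n m x y : ℕ} (a c b : ℕ) (p q : Piece) (hx : x = a + p.bot + c)
    (hy : y = a + p.top + c) (hn : n = a + p.top + c + q.top + b)
    (hm : m = a + p.bot + c + q.bot + b) :
    SameSkein n m [⟨a, p⟩, ⟨x, q⟩] [⟨y, q⟩, ⟨a, p⟩] := by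
  subst hx hy
  exact exchange a c b p q hn hm

theorem zigzag_left {n : ℕ} (a : ℕ) (h : a + 1 ≤ n) :
    SameSkein n n [⟨a + 1, .cap⟩, ⟨a, .cup⟩] [] := by
  refine of_move (.inl (.zigzag_left a)) ?_ (.nil n)
  simp only [isDiagram_cons_iff, isDiagram_nil_iff, Piece.top, Piece.bot]
  omega

theorem zigzag_right {n : ℕ} (a : ℕ) (h : a + 1 ≤ n) :
    SameSkein n n [⟨a, .cap⟩, ⟨a + 1, .cup⟩] [] := by
  refine of_move (.inl (.zigzag_right a)) ?_ (.nil n)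
  simp only [isDiagram_cons_iff, isDiagram_nil_iff, Piece.top, Piece.bot]
  omega

theorem turn_crossing {n : ℕ} (a : ℕ) (s : Bool) (h : a + 2 ≤ n) :
    SameSkein n n [⟨a, .cap⟩, ⟨a + 1, .crossing s⟩, ⟨a + 2, .cup⟩] [⟨a, .crossing !s⟩] := by
  refine of_move (.inl (.turn_crossing a s)) ?_ ?_ <;>
    simp only [isDiagram_cons_iff, isDiagram_nil_iff, Piece.top, Piece.bot] <;> omega

theorem turn_vertex_left {n m : ℕ} (a b p q : ℕ) (hn : n = a + p + b) (hm : m = a + (q + 1) + b) :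
    SameSkein n m [⟨a, .cap⟩, ⟨a + 1, .vertex (p + 1) q⟩] [⟨a, .vertex p (q + 1)⟩] := by
  refine of_move (.inl (.turn_vertex_left a p q)) ?_ ?_ <;>
    simp only [isDiagram_cons_iff, isDiagram_nil_iff, Piece.top, Piece.bot] <;> omega

theorem turn_vertex_right {n m : ℕ} (a b p q : ℕ) (hn : n = a + p + b)
    (hm : m = a + (q + 1) + b) :
    SameSkein n m [⟨a + p, .cap⟩, ⟨a, .vertex (p + 1) q⟩] [⟨a, .vertex p (q + 1)⟩] := by
  refine of_move (.inl (.turn_vertex_right a p q)) ?_ ?_ <;>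
    simp only [isDiagram_cons_iff, isDiagram_nil_iff, Piece.top, Piece.bot] <;> omega

/-- Bending the leftmost lower leg of a vertex up. -/
theorem bend_up_left {n m : ℕ} (a b p q : ℕ) (hn : n = a + (p + 1) + b) (hm : m = a + q + b) :
    SameSkein n m [⟨a + 1, .vertex p (q + 1)⟩, ⟨a, .cup⟩] [⟨a, .vertex (p + 1) q⟩] := by
  have h₁ := (turn_vertex_left (n := n) (m := m + 2) (a + 1) b p q (by omega) (by omega)).symm
  have h₂ := (exchange (n := n + 2) (m := m) a 0 b .cup (.vertex (p + 1) q)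
    (by simp only [Piece.top]; omega) (by simp only [Piece.bot]; omega)).symm
  have h₃ := zigzag_left (n := n) a (by omega)
  refine (h₁.append_right [⟨a, .cup⟩] ?_).trans ((h₂.append_left [⟨a + 1, .cap⟩] ?_).trans
    (h₃.append_right [⟨a, .vertex (p + 1) q⟩] ?_)) <;>
    simp only [isDiagram_cons_iff, isDiagram_nil_iff, Piece.top, Piece.bot] <;> omega

/-- Bending the rightmost lower leg of a vertex up. -/
theorem bend_up_right {n m : ℕ} (a b p q : ℕ) (hn : n = a + (p + 1) + b) (hm : m = a + q + b) :
    SameSkein n m [⟨a, .vertex p (q + 1)⟩, ⟨a + q, .cup⟩] [⟨a, .vertex (p + 1) q⟩] := by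
  have h₁ := (turn_vertex_right (n := n) (m := m + 2) a (b + 1) p q (by omega) (by omega)).symm
  have h₂ := exchange (n := n + 2) (m := m) a 0 b (.vertex (p + 1) q) .cup
    (by simp only [Piece.top]; omega) (by simp only [Piece.bot]; omega)
  have h₃ := zigzag_right (n := n) (a + p) (by omega)
  refine (h₁.append_right [⟨a + q, .cup⟩] ?_).trans ((h₂.append_left [⟨a + p, .cap⟩] ?_).trans
    (h₃.append_right [⟨a, .vertex (p + 1) q⟩] ?_)) <;>
    simp only [isDiagram_cons_iff, isDiagram_nil_iff, Piece.top, Piece.bot] <;> omega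

/-- A piece on the right of all strands of a word can be moved above the word. -/
theorem exchange_word {n m : ℕ} {w : List Layer} (h : IsDiagram n w m) (c b : ℕ) (q : Piece) :
    SameSkein (n + c + q.top + b) (m + c + q.bot + b) (w ++ [⟨m + c, q⟩]) (⟨n + c, q⟩ :: w) := by
  induction h with
  | nil n =>
    exact refl (by simp only [List.nil_append, isDiagram_cons_iff, isDiagram_nil_iff]; omega)
  | cons a b' p w m h ih =>
    have h₁ := ih.append_left (k := a + p.top + b' + c + q.top + b) [⟨a, p⟩]
      (by simp only [isDiagram_cons_iff, isDiagram_nil_iff]; omega)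
    have h₂ := exchange (n := a + p.top + b' + c + q.top + b)
      (m := a + p.bot + b' + c + q.bot + b) a (b' + c) b p q (by omega) (by omega)
    rw [← add_assoc, ← add_assoc] at h₂
    refine h₁.trans (h₂.append_right w ?_)
    have := h.pad (c + q.bot + b)
    simpa only [← add_assoc] using this

end SameSkein

theorem mk_eq_zero_of_yamadaRelator {x : MonoidAlgebra SkeinRing (RibbonGraph 2)}
    (h : YamadaRelator 2 x) : Ideal.Quotient.mkₐ SkeinRing (yamadaIdeal 2) x = 0 :=
  Ideal.Quotient.eq_zero_iff_mem.2 (Submodule.subset_span h)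

open SkeinRing

theorem wordClass_crossing {u v : List Layer} (a b : ℕ) (hu : IsDiagram 2 u (a + 2 + b))
    (hv : IsDiagram (a + 2 + b) v 2) :
    wordClass (u ++ [⟨a, .crossing false⟩] ++ v) = Apow 4 • wordClass (u ++ v)
      + Apow (-4) • wordClass (u ++ [⟨a, .cup⟩, ⟨a, .cap⟩] ++ v)
      - d • wordClass (u ++ [⟨a, .vertex 2 2⟩] ++ v) := by
  have t : IsDiagram 2 (u ++ [⟨a, .crossing false⟩] ++ v) 2 :=
    (hu.append (.cons a b (.crossing false) _ _ (.nil _))).append hv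
  have t₁ : IsDiagram 2 (u ++ [⟨a, .cup⟩, ⟨a, .cap⟩] ++ v) 2 :=
    (hu.append (.cons a b .cup _ _ (.cons a b .cap _ _ (.nil _)))).append hv
  have t₂ : IsDiagram 2 (u ++ [⟨a, .vertex 2 2⟩] ++ v) 2 :=
    (hu.append (.cons a b (.vertex 2 2) _ _ (.nil _))).append hv
  have h := mk_eq_zero_of_yamadaRelator
    (.crossing u v a ⟨_, t⟩ ⟨_, hu.append hv⟩ ⟨_, t₁⟩ ⟨_, t₂⟩ rfl rfl rfl rfl)
  rw [wordClass_eq t, wordClass_eq (hu.append hv), wordClass_eq t₁, wordClass_eq t₂]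
  simp only [map_sub, map_add, map_smul, sub_eq_zero] at h
  exact h

theorem wordClass_edge {u v : List Layer} (a b p q : ℕ) (hu : IsDiagram 2 u (a + p + b))
    (hv : IsDiagram (a + q + b) v 2) :
    wordClass (u ++ [⟨a, .vertex p 1⟩, ⟨a, .vertex 1 q⟩] ++ v) =
      wordClass (u ++ [⟨a, .vertex p q⟩] ++ v)
        - dInv • wordClass (u ++ [⟨a, .vertex p 0⟩, ⟨a, .vertex 0 q⟩] ++ v) := by
  have t : IsDiagram 2 (u ++ [⟨a, .vertex p 1⟩, ⟨a, .vertex 1 q⟩] ++ v) 2 :=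
    (hu.append (.cons a b (.vertex p 1) _ _ (.cons a b (.vertex 1 q) _ _ (.nil _)))).append hv
  have t₀ : IsDiagram 2 (u ++ [⟨a, .vertex p q⟩] ++ v) 2 :=
    (hu.append (.cons a b (.vertex p q) _ _ (.nil _))).append hv
  have t₁ : IsDiagram 2 (u ++ [⟨a, .vertex p 0⟩, ⟨a, .vertex 0 q⟩] ++ v) 2 :=
    (hu.append (.cons a b (.vertex p 0) _ _ (.cons a b (.vertex 0 q) _ _ (.nil _)))).append hv
  have h := mk_eq_zero_of_yamadaRelator (.edge u v a p q ⟨_, t⟩ ⟨_, t₀⟩ ⟨_, t₁⟩ rfl rfl rfl)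
  rw [wordClass_eq t, wordClass_eq t₀, wordClass_eq t₁]
  simp only [map_sub, map_smul, sub_eq_zero] at h
  exact h

theorem wordClass_loop {u v : List Layer} (a b p : ℕ) (hu : IsDiagram 2 u (a + p + b))
    (hv : IsDiagram (a + b) v 2) :
    wordClass (u ++ [⟨a, .vertex p 2⟩, ⟨a, .cup⟩] ++ v) =
      (d - dInv) • wordClass (u ++ [⟨a, .vertex p 0⟩] ++ v) := by
  have t : IsDiagram 2 (u ++ [⟨a, .vertex p 2⟩, ⟨a, .cup⟩] ++ v) 2 :=
    (hu.append (.cons a b (.vertex p 2) _ _ (.cons a b .cup _ _ (.nil _)))).append hv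
  have t₀ : IsDiagram 2 (u ++ [⟨a, .vertex p 0⟩] ++ v) 2 :=
    (hu.append (.cons a b (.vertex p 0) _ _ (.nil _))).append hv
  have h := mk_eq_zero_of_yamadaRelator (.loop u v a p ⟨_, t⟩ ⟨_, t₀⟩ rfl rfl)
  rw [wordClass_eq t, wordClass_eq t₀]
  simp only [map_sub, map_smul, sub_eq_zero] at h
  exact h

theorem wordClass_isolated {u v : List Layer} (a b : ℕ) (hu : IsDiagram 2 u (a + b))
    (hv : IsDiagram (a + b) v 2) :
    wordClass (u ++ [⟨a, .vertex 0 0⟩] ++ v) = d • wordClass (u ++ v) := by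
  have t : IsDiagram 2 (u ++ [⟨a, .vertex 0 0⟩] ++ v) 2 :=
    (hu.append (.cons a b (.vertex 0 0) _ _ (.nil _))).append hv
  have h := mk_eq_zero_of_yamadaRelator (.isolated u v a ⟨_, t⟩ ⟨_, hu.append hv⟩ rfl rfl)
  rw [wordClass_eq t, wordClass_eq (hu.append hv)]
  simp only [map_sub, map_smul, sub_eq_zero] at h
  exact h

theorem SameSkein.bivalent {n : ℕ} (a : ℕ) (h : a + 1 ≤ n) :
    SameSkein n n [⟨a, .vertex 1 1⟩] [] := by
  refine ⟨by simp only [isDiagram_cons_iff, isDiagram_nil_iff, Piece.top, Piece.bot]; omega,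
    .nil n, fun u v hu hv => ?_⟩
  have t : IsDiagram 2 (u ++ [⟨a, .vertex 1 1⟩] ++ v) 2 := by
    refine (hu.append ?_).append hv
    simp only [isDiagram_cons_iff, isDiagram_nil_iff, Piece.top, Piece.bot]
    omega
  have h := mk_eq_zero_of_yamadaRelator (.bivalent u v a ⟨_, t⟩ ⟨_, hu.append hv⟩ rfl rfl)
  rw [List.append_nil, wordClass_eq t, wordClass_eq (hu.append hv)]
  simp only [map_sub, sub_eq_zero] at h
  exact h

/-- A vertex with two lower legs is a local maximum. -/
theorem SameSkein.vertex_zero_two {n : ℕ} (a : ℕ) (h : a ≤ n) :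
    SameSkein n (n + 2) [⟨a, .vertex 0 2⟩] [⟨a, .cap⟩] := by
  have h₁ := SameSkein.turn_vertex_left (n := n) (m := n + 2) a (n - a) 0 1 (by omega) (by omega)
  have h₂ := SameSkein.bivalent (n := n + 2) (a + 1) (by omega)
  refine h₁.symm.trans (h₂.append_left [⟨a, .cap⟩] ?_)
  simp only [isDiagram_cons_iff, isDiagram_nil_iff, Piece.top, Piece.bot]
  omega

/-- The edge relation for an edge whose upper vertex has `i` further lower legs on the left and
`j` on the right of the edge. -/
theorem wordClass_edge_between (i j : ℕ) {u v : List Layer} (a b p q : ℕ)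
    (hu : IsDiagram 2 u (a + p + b)) (hv : IsDiagram (a + (i + q + j) + b) v 2) :
    wordClass (u ++ [⟨a, .vertex p (i + 1 + j)⟩, ⟨a + i, .vertex 1 q⟩] ++ v) =
      wordClass (u ++ [⟨a, .vertex p (i + q + j)⟩] ++ v)
        - dInv • wordClass (u ++ [⟨a, .vertex p (i + j)⟩, ⟨a + i, .vertex 0 q⟩] ++ v) := by
  -- The further lower legs are bent up one by one.
  induction i generalizing u a b p with
  | succ i ih =>
    have key : ∀ k y, IsDiagram (a + k + 1 + b) y (a + (i + 1 + q + j) + b) →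
        wordClass (u ++ (⟨a, .vertex p (k + 1)⟩ :: y) ++ v) =
          wordClass (u ++ [⟨a, .cap⟩] ++ (⟨a + 1, .vertex (p + 1) k⟩ :: y) ++ v) := by
      intro k y hy
      have h := SameSkein.turn_vertex_left a b p k rfl rfl
      simpa using (h.2.2 u (y ++ v) hu ((hy.cast (by omega)).append hv)).symm
    have h := ih (u := u ++ [⟨a, .cap⟩]) (a + 1) b (p + 1)
      (hu.append (by simp only [isDiagram_cons_iff, isDiagram_nil_iff, Piece.top, Piece.bot]; omega))
      (hv.cast (by omega))
    have e₁ : i + 1 + 1 + j = i + 1 + j + 1 := by omega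
    have e₂ : i + 1 + q + j = i + q + j + 1 := by omega
    have e₃ : i + 1 + j = i + j + 1 := by omega
    have e₄ : a + (i + 1) = a + 1 + i := by omega
    rw [e₁, e₄, key, h, e₂, key, e₃, key] <;>
      simp only [isDiagram_cons_iff, isDiagram_nil_iff, Piece.top, Piece.bot] <;> omega
  | zero =>
    induction j generalizing u a b p with
    | succ j ih =>
      have key : ∀ k y, IsDiagram (a + k + 1 + b) y (a + (0 + q + j + 1) + b) →
          wordClass (u ++ (⟨a, .vertex p (k + 1)⟩ :: y) ++ v) =
            wordClass (u ++ [⟨a + p, .cap⟩] ++ (⟨a, .vertex (p + 1) k⟩ :: y) ++ v) := by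
        intro k y hy
        have h := SameSkein.turn_vertex_right a b p k rfl rfl
        simpa using (h.2.2 u (y ++ v) hu ((hy.cast (by omega)).append (hv.cast (by omega)))).symm
      have h := ih (u := u ++ [⟨a + p, .cap⟩]) a (b + 1) (p + 1)
        (hu.append
          (by simp only [isDiagram_cons_iff, isDiagram_nil_iff, Piece.top, Piece.bot]; omega))
        (hv.cast (by omega))
      rw [← add_assoc, key, h, ← add_assoc, key, ← add_assoc, key] <;>
        simp only [isDiagram_cons_iff, isDiagram_nil_iff, Piece.top, Piece.bot] <;> omega
    | zero =>
      simpa using wordClass_edge a b p q hu (hv.cast (by omega))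

/-- The loop relation for a loop at a vertex with `i` further lower legs on the left and `j` on the
right of the loop. -/
theorem wordClass_loop_between (i j : ℕ) {u v : List Layer} (a b p : ℕ)
    (hu : IsDiagram 2 u (a + p + b)) (hv : IsDiagram (a + (i + j) + b) v 2) :
    wordClass (u ++ [⟨a, .vertex p (i + 2 + j)⟩, ⟨a + i, .cup⟩] ++ v) =
      (d - dInv) • wordClass (u ++ [⟨a, .vertex p (i + j)⟩] ++ v) := by
  induction i generalizing u a b p with
  | succ i ih =>
    have key : ∀ k y, IsDiagram (a + k + 1 + b) y (a + (i + 1 + j) + b) →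
        wordClass (u ++ (⟨a, .vertex p (k + 1)⟩ :: y) ++ v) =
          wordClass (u ++ [⟨a, .cap⟩] ++ (⟨a + 1, .vertex (p + 1) k⟩ :: y) ++ v) := by
      intro k y hy
      have h := SameSkein.turn_vertex_left a b p k rfl rfl
      simpa using (h.2.2 u (y ++ v) hu ((hy.cast (by omega)).append hv)).symm
    have h := ih (u := u ++ [⟨a, .cap⟩]) (a + 1) b (p + 1)
      (hu.append (by simp only [isDiagram_cons_iff, isDiagram_nil_iff, Piece.top, Piece.bot]; omega))
      (hv.cast (by omega))
    have e₁ : i + 1 + 2 + j = i + 2 + j + 1 := by omega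
    have e₃ : i + 1 + j = i + j + 1 := by omega
    have e₄ : a + (i + 1) = a + 1 + i := by omega
    rw [e₁, e₄, key, h, e₃, key] <;>
      simp only [isDiagram_cons_iff, isDiagram_nil_iff, Piece.top, Piece.bot] <;> omega
  | zero =>
    induction j generalizing u a b p with
    | succ j ih =>
      have key : ∀ k y, IsDiagram (a + k + 1 + b) y (a + (0 + j + 1) + b) →
          wordClass (u ++ (⟨a, .vertex p (k + 1)⟩ :: y) ++ v) =
            wordClass (u ++ [⟨a + p, .cap⟩] ++ (⟨a, .vertex (p + 1) k⟩ :: y) ++ v) := by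
        intro k y hy
        have h := SameSkein.turn_vertex_right a b p k rfl rfl
        simpa using (h.2.2 u (y ++ v) hu ((hy.cast (by omega)).append (hv.cast (by omega)))).symm
      have h := ih (u := u ++ [⟨a + p, .cap⟩]) a (b + 1) (p + 1)
        (hu.append
          (by simp only [isDiagram_cons_iff, isDiagram_nil_iff, Piece.top, Piece.bot]; omega))
        (hv.cast (by omega))
      rw [← add_assoc, key, h, ← add_assoc, key] <;>
        simp only [isDiagram_cons_iff, isDiagram_nil_iff, Piece.top, Piece.bot] <;> omega
    | zero =>
      simpa using wordClass_loop a b p hu (hv.cast (by omega))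

/-- A diagram with a univalent vertex vanishes. -/
theorem wordClass_univalent {u v : List Layer} (a b : ℕ) (hu : IsDiagram 2 u (a + b))
    (hv : IsDiagram (a + 1 + b) v 2) : wordClass (u ++ [⟨a, .vertex 0 1⟩] ++ v) = 0 := by
  -- A bivalent vertex is put on the edge. Its contraction gives the diagram itself, and its
  -- deletion the diagram with an additional isolated vertex.
  have h₁ := wordClass_edge a b 0 1 (hu.cast_bot (by omega)) hv
  have h₂ := (SameSkein.bivalent (n := a + 1 + b) a (by omega)).2.2 (u ++ [⟨a, .vertex 0 1⟩]) v
    (hu.append (show IsDiagram (a + b) [⟨a, .vertex 0 1⟩] (a + 1 + b) from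
      .cons a b (.vertex 0 1) _ _ (.nil _))) hv
  have h₃ := wordClass_isolated (u := u) (v := ⟨a, .vertex 0 1⟩ :: v) a b hu
    (.cons a b (.vertex 0 1) _ _ hv)
  have hd : dInv * d = 1 := by
    rw [mul_comm]
    exact IsLocalization.Away.mul_invSelf laurentD
  simp only [List.append_assoc, List.cons_append, List.nil_append, List.append_nil] at h₁ h₂ h₃ ⊢
  rw [h₃, smul_smul, hd, one_smul, sub_self] at h₁
  rw [← h₂, h₁]
/-! ### Reduction to words of vertices without upper legs -/

/-- A word all of whose pieces are vertices without upper legs and with at least two lower legs. As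
a diagram without upper endpoints it is a noncrossing partition of its lower endpoints, drawn with
one vertex for each block. -/
def IsCreation (w : List Layer) : Prop := ∀ l ∈ w, ∃ k, 2 ≤ k ∧ l.piece = .vertex 0 k

/-- The span in `𝒴₂` of the diagrams that consist of a word of vertices from `0` to `m` endpoints
on the left of the two upper strands, and of `v` below. -/
noncomputable def creationSpan (m : ℕ) (v : List Layer) : Submodule SkeinRing (YamadaAlgebra 2) :=
  Submodule.span SkeinRing {x | ∃ c, IsCreation c ∧ IsDiagram 0 c m ∧ x = wordClass (c ++ v)}

/-- The word `w` from `0` to `m` endpoints, drawn on the left of two vertical strands, is a linear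
combination of words of vertices, whatever is below. -/
def Reducible (m : ℕ) (w : List Layer) : Prop :=
  ∀ v, IsDiagram (m + 2) v 2 → wordClass (w ++ v) ∈ creationSpan m v

/-- Attaching the word `w` from `n` to `m` endpoints below a word of vertices gives a reducible
word. -/
def Absorbed (n m : ℕ) (w : List Layer) : Prop :=
  ∀ c, IsCreation c → IsDiagram 0 c n → Reducible m (c ++ w)

theorem IsCreation.reducible {m : ℕ} {c : List Layer} (h : IsCreation c) (hc : IsDiagram 0 c m) :
    Reducible m c :=
  fun _ _ => Submodule.subset_span ⟨c, h, hc, rfl⟩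

theorem Reducible.append {n m : ℕ} {w w' : List Layer} (h : Reducible n w) (h' : Absorbed n m w')
    (hw' : IsDiagram n w' m) : Reducible m (w ++ w') := by
  intro v hv
  have hx := h (w' ++ v) ((hw'.pad 2).append hv)
  rw [← List.append_assoc] at hx
  refine Submodule.span_le.2 ?_ hx
  rintro _ ⟨c, hc, hcn, rfl⟩
  rw [← List.append_assoc]
  exact h' c hc hcn v hv

theorem Reducible.of_sameSkein {n m : ℕ} {c w w' : List Layer} (hc : IsDiagram 0 c n)
    (h : SameSkein (n + 2) (m + 2) w w') (hr : Reducible m (c ++ w')) : Reducible m (c ++ w) := by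
  intro v hv
  rw [h.2.2 c v ((hc.pad 2).cast (by omega)) hv]
  exact hr v hv

theorem Absorbed.append {n k m : ℕ} {w w' : List Layer} (h : Absorbed n k w)
    (h' : Absorbed k m w') (hw' : IsDiagram k w' m) : Absorbed n m (w ++ w') := fun c hc hcn => by
  rw [← List.append_assoc]
  exact (h c hc hcn).append h' hw'

theorem Absorbed.of_sameSkein {n m : ℕ} {w w' : List Layer}
    (h : SameSkein (n + 2) (m + 2) w w') (hr : Absorbed n m w') : Absorbed n m w :=
  fun c hc hcn => (hr c hc hcn).of_sameSkein hcn h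

theorem Absorbed.vertex_zero {n : ℕ} (a k : ℕ) (ha : a ≤ n) :
    Absorbed n (n + k) [⟨a, .vertex 0 k⟩] := by
  obtain ⟨b, rfl⟩ := Nat.exists_eq_add_of_le ha
  intro c hc hcn
  have hcn' : IsDiagram 2 c (a + (b + 2)) := ((hcn.pad 2).cast (by omega)).cast_bot (by omega)
  match k with
  | 0 =>
    intro v hv
    rw [wordClass_isolated a (b + 2) hcn' (hv.cast (by omega))]
    exact Submodule.smul_mem _ _ (hc.reducible hcn v hv)
  | 1 =>
    intro v hv
    rw [wordClass_univalent a (b + 2) hcn' (hv.cast (by omega))]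
    exact zero_mem _
  | k + 2 =>
    refine IsCreation.reducible ?_ (hcn.append ?_)
    · intro l hl
      rcases List.mem_append.1 hl with hl | hl
      · exact hc l hl
      · rw [List.mem_singleton.1 hl]
        exact ⟨k + 2, by omega, rfl⟩
    · simp only [isDiagram_cons_iff, isDiagram_nil_iff, Piece.top, Piece.bot]
      omega

/-- The last vertex of a nonempty word of vertices. -/
theorem IsCreation.exists_of_append {n : ℕ} {c : List Layer} {l : Layer}
    (h : IsCreation (c ++ [l])) (hn : IsDiagram 0 (c ++ [l]) n) :
    ∃ b b' k, IsCreation c ∧ IsDiagram 0 c (b + b') ∧ l = ⟨b, .vertex 0 k⟩ ∧ 2 ≤ k ∧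
      n = b + b' + k := by
  obtain ⟨k, hk, hl⟩ := h l (by simp)
  obtain ⟨b, p⟩ := l
  obtain rfl : p = .vertex 0 k := hl
  obtain ⟨n', hc, hn⟩ := isDiagram_append_iff.1 hn
  simp only [isDiagram_cons_iff, isDiagram_nil_iff, Piece.top, Piece.bot] at hn
  refine ⟨b, n' - b, k, fun l hl => h l (by simp [hl]), hc.cast_bot (by omega), rfl, hk, by omega⟩

theorem Absorbed.vertex_one {n m : ℕ} (a q : ℕ) (ha : a + 1 ≤ n) (hm : m + 1 = n + q) :
    Absorbed n m [⟨a, .vertex 1 q⟩] := by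
  intro c
  induction c using List.reverseRecOn generalizing n m a with
  | nil =>
    intro _ h
    rw [isDiagram_nil_iff] at h
    omega
  | append_singleton c l ih =>
    intro hc hn
    obtain ⟨b, b', k, hc', hcn, rfl, hk, rfl⟩ := hc.exists_of_append hn
    replace hc := hc'
    rw [List.append_assoc, List.cons_append, List.nil_append]
    rcases lt_or_ge a b with hab | hab
    · -- The strand is on the left of the last vertex.
      obtain ⟨e, rfl⟩ := Nat.exists_eq_add_of_lt hab
      have h := SameSkein.exchange_of_eq (n := a + e + 1 + b' + 2) (m := m + 2) (x := a + q + e)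
        (y := a + e + 1) a e (b' + 2) (.vertex 1 q) (.vertex 0 k)
        rfl (by simp only [Piece.top]; omega) (by simp only [Piece.top]; omega)
        (by simp only [Piece.bot]; omega)
      refine Reducible.of_sameSkein hcn (h.symm) ?_
      have := (ih (n := a + e + 1 + b') (m := a + e + b' + q) a (by omega) (by omega) hc
        hcn).append (Absorbed.vertex_zero (a + q + e) k (by omega))
        (by simp only [isDiagram_cons_iff, isDiagram_nil_iff, Piece.top, Piece.bot]; omega)
      obtain rfl : m = a + e + b' + q + k := by omega
      simpa using this
    rcases lt_or_ge a (b + k) with hak | hak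
    · -- The strand is a leg of the last vertex.
      obtain ⟨i, rfl⟩ := Nat.exists_eq_add_of_le hab
      obtain ⟨j, rfl⟩ : ∃ j, k = i + 1 + j := ⟨k - (i + 1), by omega⟩
      intro v hv
      rw [wordClass_edge_between i j b (b' + 2) 0 q
        (((hcn.pad 2).cast (by omega)).cast_bot (by omega)) (hv.cast (by omega))]
      have h₁ := Absorbed.vertex_zero (n := b + b') b (i + q + j) (by omega) c hc hcn
      have h₂ := (Absorbed.vertex_zero (n := b + b') b (i + j) (by omega)).append
        (Absorbed.vertex_zero (b + i) q (by omega))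
        (by simp only [isDiagram_cons_iff, isDiagram_nil_iff, Piece.top, Piece.bot]; omega) c hc hcn
      rw [show b + b' + (i + q + j) = m by omega] at h₁
      rw [show b + b' + (i + j) + q = m by omega] at h₂
      exact Submodule.sub_mem _ (h₁ v hv) (Submodule.smul_mem _ _ (h₂ v hv))
    · -- The strand is on the right of the last vertex.
      obtain ⟨e, rfl⟩ := Nat.exists_eq_add_of_le hak
      have h := SameSkein.exchange_of_eq (n := b + b' + 2) (m := m + 2) (x := b + k + e)
        (y := b + e) b e (b' + 1 - e)
        (.vertex 0 k) (.vertex 1 q) rfl rfl (by simp only [Piece.top]; omega)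
        (by simp only [Piece.bot]; omega)
      refine Reducible.of_sameSkein hcn h ?_
      have := (ih (n := b + b') (m := b + b' + q - 1) (b + e) (by omega) (by omega) hc
        hcn).append (Absorbed.vertex_zero b k (by omega))
        (by simp only [isDiagram_cons_iff, isDiagram_nil_iff, Piece.top, Piece.bot]; omega)
      obtain rfl : m = b + b' + q - 1 + k := by omega
      simpa using this

theorem Absorbed.cup {n m : ℕ} (a : ℕ) (ha : a ≤ m) (hn : n = m + 2) :
    Absorbed n m [⟨a, .cup⟩] := by
  subst hn
  intro c
  induction c using List.reverseRecOn generalizing m a with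
  | nil =>
    intro _ h
    rw [isDiagram_nil_iff] at h
    omega
  | append_singleton c l ih =>
    intro hc hn
    obtain ⟨b, b', k, hc', hcn, rfl, hk, hm⟩ := hc.exists_of_append hn
    replace hc := hc'
    rw [List.append_assoc, List.cons_append, List.nil_append]
    rcases Nat.lt_or_ge (a + 1) b with hab | hab
    · -- Both strands are on the left of the last vertex.
      obtain ⟨e, rfl⟩ := Nat.exists_eq_add_of_lt hab
      have h := SameSkein.exchange_of_eq (n := a + 1 + e + 1 + b' + 2) (m := m + 2) (x := a + e)
        (y := a + 1 + e + 1) a e (b' + 2) .cup (.vertex 0 k)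
        rfl (by simp only [Piece.top]; omega) (by simp only [Piece.top]; omega)
        (by simp only [Piece.bot]; omega)
      refine Reducible.of_sameSkein hcn (h.symm) ?_
      have := (ih (m := a + e + b') a (by omega) hc (hcn.cast_bot (by omega))).append
        (Absorbed.vertex_zero (a + e) k (by omega))
        (by simp only [isDiagram_cons_iff, isDiagram_nil_iff, Piece.top, Piece.bot]; omega)
      obtain rfl : m = a + e + b' + k := by omega
      simpa using this
    obtain rfl | hab := hab.eq_or_lt
    · -- The second strand is the first leg of the last vertex.
      obtain ⟨k, rfl⟩ : ∃ k', k = k' + 1 := ⟨k - 1, by omega⟩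
      have h := SameSkein.bend_up_left (n := a + 1 + b' + 2) (m := m + 2) a (b' + 2) 0 k
        (by omega) (by omega)
      exact Reducible.of_sameSkein hcn h
        (Absorbed.vertex_one a k (by omega) (by omega) c hc hcn)
    rcases Nat.lt_or_ge (a + 1) (b + k) with hak | hak
    · -- Both strands are legs of the last vertex.
      obtain ⟨i, rfl⟩ := Nat.exists_eq_add_of_le (Nat.lt_succ_iff.1 hab)
      obtain ⟨j, rfl⟩ : ∃ j, k = i + 2 + j := ⟨k - (i + 2), by omega⟩
      intro v hv
      rw [wordClass_loop_between i j b (b' + 2) 0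
        (((hcn.pad 2).cast (by omega)).cast_bot (by omega)) (hv.cast (by omega))]
      have h₁ := Absorbed.vertex_zero (n := b + b') b (i + j) (by omega) c hc hcn
      rw [show b + b' + (i + j) = m by omega] at h₁
      exact Submodule.smul_mem _ _ (h₁ v hv)
    obtain hak | hak := hak.eq_or_lt
    · -- The first strand is the last leg of the last vertex.
      obtain ⟨k, rfl⟩ : ∃ k', k = k' + 1 := ⟨k - 1, by omega⟩
      obtain rfl : a = b + k := by omega
      have h := SameSkein.bend_up_right (n := b + b' + 2) (m := m + 2) b (b' + 1) 0 k
        (by omega) (by omega)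
      exact Reducible.of_sameSkein hcn h
        (Absorbed.vertex_one b k (by omega) (by omega) c hc hcn)
    · -- Both strands are on the right of the last vertex.
      obtain ⟨e, rfl⟩ := Nat.exists_eq_add_of_le (Nat.lt_succ_iff.1 hak)
      have h := SameSkein.exchange_of_eq (n := b + b' + 2) (m := m + 2) (x := b + k + e)
        (y := b + e) b e (b' - e)
        (.vertex 0 k) .cup rfl rfl (by simp only [Piece.top]; omega)
        (by simp only [Piece.bot]; omega)
      refine Reducible.of_sameSkein hcn h ?_
      have := (ih (m := b + b' - 2) (b + e) (by omega) hc (hcn.cast_bot (by omega))).append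
        (Absorbed.vertex_zero b k (by omega))
        (by simp only [isDiagram_cons_iff, isDiagram_nil_iff, Piece.top, Piece.bot]; omega)
      obtain rfl : m = b + b' - 2 + k := by omega
      simpa using this

theorem Absorbed.vertex {n m : ℕ} (a b p q : ℕ) (hn : n = a + p + b) (hm : m = a + q + b) :
    Absorbed n m [⟨a, .vertex p q⟩] := by
  induction p generalizing n m a q with
  | zero =>
    obtain rfl : m = n + q := by omega
    exact Absorbed.vertex_zero a q (by omega)
  | succ p ih =>
    refine Absorbed.of_sameSkein
      (SameSkein.bend_up_left a (b + 2) p q (by omega) (by omega)).symm ?_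
    refine (ih (m := m + 2) (a + 1) (q + 1) (by omega) (by omega)).append
      (Absorbed.cup a (by omega) rfl) ?_
    simp only [isDiagram_cons_iff, isDiagram_nil_iff, Piece.top, Piece.bot]
    omega

theorem Absorbed.cap {n m : ℕ} (a : ℕ) (ha : a ≤ n) (hm : m = n + 2) :
    Absorbed n m [⟨a, .cap⟩] := by
  subst hm
  exact Absorbed.of_sameSkein (SameSkein.vertex_zero_two (n := n + 2) a (by omega)).symm
    (Absorbed.vertex_zero a 2 ha)

theorem Absorbed.crossing {n : ℕ} (a : ℕ) (s : Bool) (ha : a + 2 ≤ n) :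
    Absorbed n n [⟨a, .crossing s⟩] := by
  have key : ∀ {n : ℕ} (a : ℕ), a + 2 ≤ n → Absorbed n n [⟨a, .crossing false⟩] := by
    intro n a ha c hc hcn v hv
    obtain ⟨b, rfl⟩ := Nat.exists_eq_add_of_le ha
    rw [wordClass_crossing a (b + 2) ((hcn.pad 2).cast (by omega)) hv]
    refine sub_mem (add_mem ?_ ?_) ?_ <;> refine Submodule.smul_mem _ _ ?_
    · exact hc.reducible hcn v hv
    · refine (Absorbed.cup a (m := a + b) (by omega) (by omega)).append
        (Absorbed.cap a (by omega) (by omega)) ?_ c hc hcn v hv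
      simp only [isDiagram_cons_iff, isDiagram_nil_iff, Piece.top, Piece.bot]
      omega
    · exact Absorbed.vertex a b 2 2 rfl rfl c hc hcn v hv
  cases s
  · exact key a ha
  · refine Absorbed.of_sameSkein (SameSkein.turn_crossing a false (by omega)).symm ?_
    refine ((Absorbed.cap a (by omega) rfl).append (key (a + 1) (by omega)) ?_).append
      (Absorbed.cup (a + 2) (by omega) rfl) ?_ <;>
    simp only [isDiagram_cons_iff, isDiagram_nil_iff, Piece.top, Piece.bot] <;> omega

/-- Every word without upper endpoints is a linear combination of words of vertices. -/
theorem IsDiagram.reducible {m : ℕ} {w : List Layer} (h : IsDiagram 0 w m) : Reducible m w := by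
  suffices key : ∀ n w, IsDiagram n w m → ∀ w', Reducible n w' → Reducible m (w' ++ w) from
    key 0 w h [] (IsCreation.reducible (by simp [IsCreation]) (.nil 0))
  clear h w
  intro n w h
  induction h with
  | nil n => simp
  | cons a b p w m h ih =>
    intro w' hw'
    have : Absorbed (a + p.top + b) (a + p.bot + b) [⟨a, p⟩] := by
      cases p with
      | cap => exact Absorbed.cap (n := a + 0 + b) (m := a + 2 + b) a (by omega) (by omega)
      | cup => exact Absorbed.cup (n := a + 2 + b) (m := a + 0 + b) a (by omega) (by omega)
      | crossing s => exact Absorbed.crossing a s (by simp only [Piece.top]; omega)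
      | vertex p q => exact Absorbed.vertex a b p q rfl rfl
    simpa using ih _ (hw'.append this (.cons a b p _ _ (.nil _)))

/-! ### Generators of the graph algebra -/

theorem SameSkein.two_caps_two_cups_nested :
    SameSkein 2 2 [⟨0, .cap⟩, ⟨1, .cap⟩, ⟨3, .cup⟩, ⟨2, .cup⟩] [] := by
  have h₁ := exchange_of_eq (n := 4) (m := 4) (x := 3) (y := 1) 1 0 1 .cap .cup rfl rfl rfl rfl
  have h₂ := zigzag_right (n := 2) 0 (by omega)
  have h₃ := zigzag_right (n := 2) 1 (by omega)
  refine ((h₁.append_left [⟨0, .cap⟩] ?_).append_right [⟨2, .cup⟩] ?_).trans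
    ((h₂.append_right [⟨1, .cap⟩, ⟨2, .cup⟩] ?_).trans h₃) <;>
  simp [isDiagram_cons_iff, isDiagram_nil_iff, Piece.top, Piece.bot]

theorem SameSkein.two_caps_two_cups :
    SameSkein 2 2 [⟨0, .cap⟩, ⟨0, .cap⟩, ⟨3, .cup⟩, ⟨2, .cup⟩] [⟨0, .cup⟩, ⟨0, .cap⟩] := by
  have h₁ := exchange_of_eq (n := 4) (m := 4) (x := 3) (y := 1) 0 1 1 .cap .cup rfl rfl rfl rfl
  have h₂ := zigzag_right (n := 2) 0 (by omega)
  have h₃ := exchange_of_eq (n := 2) (m := 2) (x := 2) (y := 0) 0 0 0 .cap .cup rfl rfl rfl rfl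
  refine ((h₁.append_left [⟨0, .cap⟩] ?_).append_right [⟨2, .cup⟩] ?_).trans
    ((h₂.append_right [⟨0, .cap⟩, ⟨2, .cup⟩] ?_).trans h₃) <;>
  simp [isDiagram_cons_iff, isDiagram_nil_iff, Piece.top, Piece.bot]

theorem SameSkein.four_valent :
    SameSkein 2 2 [⟨0, .vertex 0 4⟩, ⟨3, .cup⟩, ⟨2, .cup⟩] [⟨0, .vertex 2 2⟩] := by
  have h₁ := bend_up_right (n := 2) (m := 4) 0 1 0 3 rfl rfl
  have h₂ := bend_up_right (n := 2) (m := 2) 0 0 1 2 rfl rfl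
  refine (h₁.append_right [⟨2, .cup⟩] ?_).trans h₂
  simp [isDiagram_cons_iff, isDiagram_nil_iff, Piece.top, Piece.bot]

theorem SameSkein.two_bivalent {n x y : ℕ} (hx : x ≤ n) (hy : y ≤ n + 2) :
    SameSkein n (n + 4) [⟨x, .vertex 0 2⟩, ⟨y, .vertex 0 2⟩] [⟨x, .cap⟩, ⟨y, .cap⟩] := by
  refine ((vertex_zero_two x hx).append_right [⟨y, .vertex 0 2⟩] ?_).trans
    ((vertex_zero_two y hy).append_left [⟨x, .cap⟩] ?_) <;>
  simp only [isDiagram_cons_iff, isDiagram_nil_iff, Piece.top, Piece.bot] <;> omega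

/-- The three words of vertices with four lower endpoints, up to exchanging the vertices. -/
theorem IsCreation.cases_four {c : List Layer} (hc : IsCreation c) (h : IsDiagram 0 c 4) :
    c = [⟨0, .vertex 0 4⟩] ∨ ∃ a ≤ 2, c = [⟨0, .vertex 0 2⟩, ⟨a, .vertex 0 2⟩] := by
  have hn : ∀ {n m c}, IsCreation c → IsDiagram n c m → n + 2 * c.length ≤ m := by
    intro n m c
    induction c generalizing n with
    | nil => intro _ h; rw [isDiagram_nil_iff] at h; simp [h]
    | cons l c ih =>
      intro hc h
      obtain ⟨k, hk, hl⟩ := hc l (by simp)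
      obtain ⟨b, p⟩ := l
      obtain rfl : p = .vertex 0 k := hl
      rw [isDiagram_cons_iff] at h
      have := ih (fun l hl => hc l (by simp [hl])) h.2
      simp only [Piece.top, Piece.bot] at this
      simp only [List.length_cons]
      omega
  match c with
  | [] => rw [isDiagram_nil_iff] at h; omega
  | [l] =>
    obtain ⟨k, hk, hl⟩ := hc l (by simp)
    obtain ⟨b, p⟩ := l
    obtain rfl : p = .vertex 0 k := hl
    simp only [isDiagram_cons_iff, isDiagram_nil_iff, Piece.top, Piece.bot] at h
    obtain ⟨rfl, rfl⟩ : b = 0 ∧ k = 4 := by omega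
    exact .inl rfl
  | [l, l'] =>
    obtain ⟨k, hk, hl⟩ := hc l (by simp)
    obtain ⟨k', hk', hl'⟩ := hc l' (by simp)
    obtain ⟨b, p⟩ := l
    obtain ⟨b', p'⟩ := l'
    obtain rfl : p = .vertex 0 k := hl
    obtain rfl : p' = .vertex 0 k' := hl'
    simp only [isDiagram_cons_iff, isDiagram_nil_iff, Piece.top, Piece.bot] at h
    obtain ⟨rfl, rfl, rfl⟩ : b = 0 ∧ k = 2 ∧ k' = 2 := by omega
    exact .inr ⟨b', by omega, rfl⟩
  | l :: l' :: l'' :: c =>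
    have := hn hc h
    simp only [List.length_cons] at this
    omega

theorem skein_mem_span (D : Diagram 2 2) :
    D.skein ∈ Submodule.span SkeinRing
      {(1 : YamadaAlgebra 2), diagramV.skein, diagramX.skein} := by
  obtain ⟨w, hw⟩ := D
  have h₁ : wordClass [] = (1 : YamadaAlgebra 2) := wordClass_eq (.nil 2)
  have hV : wordClass [⟨0, .cup⟩, ⟨0, .cap⟩] = diagramV.skein := wordClass_eq diagramV.2
  have hX : wordClass [⟨0, .vertex 2 2⟩] = diagramX.skein := wordClass_eq diagramX.2
  have eq_of {w w'} (h : SameSkein 2 2 w w') : wordClass w = wordClass w' := by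
    simpa using h.2.2 [] [] (.nil 2) (.nil 2)
  have tc : IsDiagram 0 [⟨0, .cap⟩, ⟨1, .cap⟩] 4 := by
    simp [isDiagram_cons_iff, isDiagram_nil_iff, Piece.top, Piece.bot]
  have tv : IsDiagram 6 [⟨3, .cup⟩, ⟨2, .cup⟩] 2 := by
    simp [isDiagram_cons_iff, isDiagram_nil_iff, Piece.top, Piece.bot]
  -- The upper endpoints of `w` are bent down, and up again further right.
  have e : SameSkein 2 2 w ([⟨0, .cap⟩, ⟨1, .cap⟩] ++ w ++ [⟨3, .cup⟩, ⟨2, .cup⟩]) := by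
    have x₁ := (SameSkein.exchange_word hw 1 1 .cup).append_right [⟨2, .cup⟩]
      (k := 2) (by simp [isDiagram_cons_iff, isDiagram_nil_iff, Piece.top, Piece.bot])
    have x₂ := (SameSkein.exchange_word hw 0 0 .cup).append_left [⟨3, .cup⟩]
      (k := 6) (by simp [isDiagram_cons_iff, isDiagram_nil_iff, Piece.top, Piece.bot])
    have x := ((by simpa [Piece.top] using x₁ : SameSkein 6 2 _ _).trans
      (by simpa [Piece.bot] using x₂)).append_left
      [⟨0, .cap⟩, ⟨1, .cap⟩] (tc.pad 2)
    have y := SameSkein.two_caps_two_cups_nested.append_right w hw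
    simpa using (x.trans (by simpa using y)).symm
  have hmem := ((tc.append (hw.pad 2)).reducible) [⟨3, .cup⟩, ⟨2, .cup⟩] tv
  rw [← wordClass_eq hw, eq_of e]
  refine Submodule.span_le.2 ?_ hmem
  rintro _ ⟨c, hc, hct, rfl⟩
  obtain rfl | ⟨a, ha, rfl⟩ := hc.cases_four hct
  · refine Submodule.subset_span (.inr (.inr ?_))
    rw [Set.mem_singleton_iff, ← hX]
    exact eq_of SameSkein.four_valent
  have ev : wordClass ([⟨0, .vertex 0 2⟩, ⟨a, .vertex 0 2⟩] ++ [⟨3, .cup⟩, ⟨2, .cup⟩]) =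
      wordClass ([⟨0, .cap⟩, ⟨a, .cap⟩] ++ [⟨3, .cup⟩, ⟨2, .cup⟩]) :=
    eq_of ((SameSkein.two_bivalent (by omega) (by omega)).append_right _ tv)
  rw [SetLike.mem_coe, ev]
  interval_cases a
  · refine Submodule.subset_span (.inr (.inl ?_))
    rw [← hV]
    exact eq_of SameSkein.two_caps_two_cups
  · refine Submodule.subset_span (.inl ?_)
    rw [← h₁]
    exact eq_of SameSkein.two_caps_two_cups_nested
  · refine Submodule.subset_span (.inr (.inl ?_))
    rw [← hV]
    have := SameSkein.exchange_of_eq (n := 2) (m := 6) (x := 2) (y := 0) 0 0 2 .cap .cap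
      rfl rfl rfl rfl
    exact eq_of ((this.append_right _ tv).trans SameSkein.two_caps_two_cups)

theorem span_generators_eq_top :
    Submodule.span SkeinRing {(1 : YamadaAlgebra 2), diagramV.skein, diagramX.skein} = ⊤ := by
  refine eq_top_iff.2 fun y _ => ?_
  obtain ⟨x, rfl⟩ := Ideal.Quotient.mkₐ_surjective SkeinRing (yamadaIdeal 2) y
  induction x using MonoidAlgebra.induction_on with
  | of g =>
    obtain ⟨D⟩ := g
    exact skein_mem_span D
  | add f g hf hg => rw [map_add]; exact add_mem (hf trivial) (hg trivial)
  | smul r f hf => rw [map_smul]; exact Submodule.smul_mem _ _ (hf trivial)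
/-! ### The colouring model -/

open Finset in
theorem sum_mul_sum_indicator {C K : Type} [DecidableEq C] [CommRing K] (S : Finset C) (x x' : C) (B B' a c : K) :
    ∑ z ∈ S, ((if z = x then B else 0) + a) * (c + (if z = x' then B' else 0)) =
      (if x ∈ S then B * c else 0) + (if x' ∈ S then B' * a else 0)
        + (if x = x' ∧ x ∈ S then B * B' else 0) + S.card * (a * c) := by
  have h : ∀ z, ((if z = x then B else 0) + a) * (c + (if z = x' then B' else 0)) =
      (if z = x then B * c else 0) + (if z = x' then B' * a else 0)
        + (if z = x then if x = x' then B * B' else 0 else 0) + a * c := by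
    intro z
    split_ifs <;> simp_all <;> ring
  simp only [h, sum_add_distrib, sum_ite_eq', sum_const, nsmul_eq_mul]
  congr 2
  by_cases hx : x = x'
  · subst hx; simp
  · simp [hx]

/-- Weights for colourings of the regions of a diagram with colours from `C`, in which regions on
both sides of a strand have different colours: `B` stands for `A⁴`, `B'` for `A⁻⁴`, and `δ`
for `d`. The number of colours has to be `d² = A⁴ + 2 + A⁻⁴`. -/
structure ColourWeights (C K : Type) [Fintype C] [Field K] where
  B : K
  B' : K
  δ : K
  mul_eq_one : B * B' = 1
  card_eq : (Fintype.card C : K) = B + 2 + B'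
  sq_eq : δ ^ 2 = Fintype.card C
  ne_zero : δ ≠ 0

namespace ColourWeights

open Finset

variable {C K : Type} [Fintype C] [Field K]

/-- The weights for the mirror image. -/
def swap (M : ColourWeights C K) : ColourWeights C K where
  B := M.B'
  B' := M.B
  δ := M.δ
  mul_eq_one := by rw [mul_comm, M.mul_eq_one]
  card_eq := by rw [M.card_eq]; ring
  sq_eq := M.sq_eq
  ne_zero := M.ne_zero

/-- The weights to be used at a crossing of the given kind. -/
def ofSign (M : ColourWeights C K) (s : Bool) : ColourWeights C K := if s then M.swap else M

theorem ofSign_not (M : ColourWeights C K) (s : Bool) : M.ofSign (!s) = (M.ofSign s).swap := by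
  cases s <;> rfl

variable [DecidableEq C]

/-- The weight of a crossing between regions coloured `l` on the left, `t` at the top, `b` at the
bottom and `r` on the right. -/
def crossingWeight (M : ColourWeights C K) (l t b r : C) : K :=
  (if t = b then M.B else 0) + (if l = r then M.B' else 0) - 1

/-- The sum of `f (y₀, …, y_q = r, z)` over all proper colourings `y₀ = l, …, y_q = r`, as a function
of the list `(r, z)`. -/
def pathSum : ℕ → C → (List C → K) →ₗ[K] (List C → K)
  | 0, l =>
    { toFun := fun f x => if x.head? = some l then f x else 0
      map_add' := fun f g => by ext x; simp only [Pi.add_apply]; split_ifs <;> simp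
      map_smul' := fun c f => by ext x; simp }
  | q + 1, l => ∑ m with m ≠ l, pathSum q m ∘ₗ LinearMap.funLeft K K (List.cons l)

/-- A vertex, acting on functions of the colours of the regions from left to right: from functions
of the colours below the vertex to functions of the colours above. -/
def vertexOp (M : ColourWeights C K) (p q : ℕ) : (List C → K) →ₗ[K] (List C → K) where
  toFun := fun f x => match x with
    | [] => 0
    | l :: x => M.δ ^ (1 - q : ℤ) * pathSum q l f ((l :: x).drop p)
  map_add' := fun f g => by ext x; cases x <;> simp [mul_add]
  map_smul' := fun c f => by ext x; cases x <;> simp; ring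

/-- A crossing, acting on functions of the colours. -/
def crossingOp (M : ColourWeights C K) : (List C → K) →ₗ[K] (List C → K) where
  toFun := fun f x => match x with
    | l :: t :: r :: z => ∑ b with b ≠ l ∧ b ≠ r, M.crossingWeight l t b r * f (l :: b :: r :: z)
    | _ => 0
  map_add' := fun f g => by
    ext x
    match x with
    | l :: t :: r :: z => simp [mul_add, sum_add_distrib]
    | [] | [_] | [_, _] => simp
  map_smul' := fun c f => by
    ext x
    match x with
    | l :: t :: r :: z => simp [mul_sum, mul_left_comm]
    | [] | [_] | [_, _] => simp

/-- The action of a piece. Local extrema are treated as vertices. -/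
def pieceOp (M : ColourWeights C K) : Piece → (List C → K) →ₗ[K] (List C → K)
  | .cap => M.vertexOp 0 2
  | .cup => M.vertexOp 2 0
  | .crossing s => (M.ofSign s).crossingOp
  | .vertex p q => M.vertexOp p q

/-- The action of a piece with `a` strands on its left. -/
def layerOp (M : ColourWeights C K) : ℕ → Piece → (List C → K) →ₗ[K] (List C → K)
  | 0, p => M.pieceOp p
  | a + 1, p =>
    { toFun := fun f x => match x with
        | [] => 0
        | c :: x => layerOp M a p (LinearMap.funLeft K K (List.cons c) f) x
      map_add' := fun f g => by ext x; cases x <;> simp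
      map_smul' := fun c f => by ext x; cases x <;> simp }

/-- The action of a word. -/
def wordOp (M : ColourWeights C K) : List Layer → (List C → K) →ₗ[K] (List C → K)
  | [] => LinearMap.id
  | ⟨a, p⟩ :: w => M.layerOp a p ∘ₗ wordOp M w

theorem wordOp_append (M : ColourWeights C K) (w w' : List Layer) (f : List C → K) :
    M.wordOp (w ++ w') f = M.wordOp w (M.wordOp w' f) := by
  induction w with
  | nil => rfl
  | cons l w ih => simp [wordOp, ih]

theorem pathSum_zero (l r : C) (f : List C → K) (z : List C) :
    pathSum 0 l f (r :: z) = if r = l then f (r :: z) else 0 := by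
  simp [pathSum]

theorem pathSum_succ (q : ℕ) (l : C) (f : List C → K) (x : List C) :
    pathSum (q + 1) l f x = ∑ m with m ≠ l, pathSum q m (fun y => f (l :: y)) x := by
  rw [pathSum, LinearMap.sum_apply, Finset.sum_apply]
  rfl

theorem pathSum_one (l r : C) (f : List C → K) (z : List C) :
    pathSum 1 l f (r :: z) = if r = l then 0 else f (l :: r :: z) := by
  simp only [pathSum_succ, pathSum_zero, sum_filter]
  rw [sum_eq_single r] <;> aesop

theorem pathSum_two (l r : C) (f : List C → K) (z : List C) :
    pathSum 2 l f (r :: z) = ∑ m with m ≠ l ∧ m ≠ r, f (l :: m :: r :: z) := by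
  simp only [pathSum_succ 1, pathSum_one, sum_filter]
  refine sum_congr rfl fun m _ => ?_
  by_cases h : m = l <;> by_cases h' : m = r <;> simp_all [eq_comm]

/-- Paths may also be summed starting from their last step. -/
theorem pathSum_succ_last (q : ℕ) (l r : C) (f : List C → K) (z : List C) :
    pathSum (q + 1) l f (r :: z) = ∑ m with m ≠ r, pathSum q l f (m :: r :: z) := by
  induction q generalizing l f with
  | zero =>
    simp only [Nat.zero_add, pathSum_one, pathSum_zero, sum_filter]
    rw [sum_eq_single l] <;> simp +contextual [eq_comm]
  | succ q ih =>
    rw [pathSum_succ]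
    simp only [ih]
    simp only [pathSum_succ]
    rw [sum_comm]

theorem pathSum_congr_head (q : ℕ) (l : C) {f g : List C → K} (x : List C)
    (h : ∀ y, y.head? = some l → f y = g y) : pathSum q l f x = pathSum q l g x := by
  cases q with
  | zero =>
    simp only [pathSum, LinearMap.coe_mk, AddHom.coe_mk]
    split_ifs with hx
    · exact h x hx
    · rfl
  | succ q =>
    simp only [pathSum_succ]
    refine sum_congr rfl fun m _ => congrArg (fun f => pathSum q m f x) (funext fun y => h _ rfl)

/-- Only lists without repeated neighbours contribute to a sum over paths. -/
theorem pathSum_congr (q : ℕ) (l : C) {f g : List C → K} {x : List C} (hx : x.IsChain (· ≠ ·))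
    (h : ∀ y : List C, y.IsChain (· ≠ ·) → y.head? = some l → y.length = x.length + q → f y = g y) :
    pathSum q l f x = pathSum q l g x := by
  induction q generalizing l f g with
  | zero =>
    simp only [pathSum, LinearMap.coe_mk, AddHom.coe_mk]
    split_ifs with hl
    · exact h x hx hl rfl
    · rfl
  | succ q ih =>
    simp only [pathSum_succ]
    refine sum_congr rfl fun m hm => ih m fun y hy hym hyl => h _ ?_ rfl ?_
    · rw [List.isChain_cons]
      refine ⟨fun z hz => ?_, hy⟩
      rw [hym, Option.mem_some_iff] at hz
      rw [← hz]
      exact (mem_filter.1 hm).2.symm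
    · rw [List.length_cons, hyl, add_assoc]

theorem vertexOp_cons (M : ColourWeights C K) (p q : ℕ) (f : List C → K) (l : C) (x : List C) :
    M.vertexOp p q f (l :: x) = M.δ ^ (1 - q : ℤ) * pathSum q l f ((l :: x).drop p) := rfl

theorem vertexOp_append (M : ColourWeights C K) (p q : ℕ) (f : List C → K) (l : C) (x y : List C)
    (hx : x.length = p) (hl : (x ++ y).head? = some l) :
    M.vertexOp p q f (x ++ y) = M.δ ^ (1 - q : ℤ) * pathSum q l f y := by
  subst hx
  obtain ⟨z, hz⟩ : ∃ z, x ++ y = l :: z := by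
    cases h : x ++ y with
    | nil => simp [h] at hl
    | cons c z => rw [h] at hl; simp_all
  rw [hz, vertexOp_cons, ← hz, List.drop_left]

theorem crossingOp_cons (M : ColourWeights C K) (f : List C → K) (l t r : C) (z : List C) :
    M.crossingOp f (l :: t :: r :: z) =
      ∑ b with b ≠ l ∧ b ≠ r, M.crossingWeight l t b r * f (l :: b :: r :: z) := rfl

theorem layerOp_succ (M : ColourWeights C K) (a : ℕ) (p : Piece) (f : List C → K) (c : C)
    (x : List C) : M.layerOp (a + 1) p f (c :: x) = M.layerOp a p (fun y => f (c :: y)) x := rfl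

theorem layerOp_append (M : ColourWeights C K) (a : ℕ) (p : Piece) (f : List C → K)
    (x y : List C) : M.layerOp (x.length + a) p f (x ++ y) =
      M.layerOp a p (fun z => f (x ++ z)) y := by
  induction x generalizing f with
  | nil => simp
  | cons c x ih =>
    rw [List.length_cons, Nat.add_right_comm, List.cons_append, layerOp_succ, ih]
    rfl

theorem capOp_cons (M : ColourWeights C K) (f : List C → K) (l : C) (z : List C) :
    M.pieceOp .cap f (l :: z) = M.δ⁻¹ * ∑ m with m ≠ l, f (l :: m :: l :: z) := by
  rw [pieceOp, vertexOp_cons, List.drop_zero, pathSum_two]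
  norm_num

theorem cupOp_cons (M : ColourWeights C K) (f : List C → K) (l t r : C) (z : List C) :
    M.pieceOp .cup f (l :: t :: r :: z) = if r = l then M.δ * f (r :: z) else 0 := by
  rw [pieceOp, vertexOp_cons]
  simp [pathSum_zero]

theorem vertexOp_congr_head (M : ColourWeights C K) (p q : ℕ) {f g : List C → K} (x : List C)
    (h : ∀ y, y.head? = x.head? → f y = g y) : M.vertexOp p q f x = M.vertexOp p q g x := by
  cases x with
  | nil => rfl
  | cons l x => rw [vertexOp_cons, vertexOp_cons, pathSum_congr_head _ _ _ h]

/-- Layers preserve the colour of the leftmost region. -/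
theorem layerOp_congr_head (M : ColourWeights C K) (a : ℕ) (p : Piece) {f g : List C → K}
    (x : List C) (h : ∀ y, y.head? = x.head? → f y = g y) :
    M.layerOp a p f x = M.layerOp a p g x := by
  cases a with
  | zero =>
    cases p with
    | cap | cup | vertex p q => exact M.vertexOp_congr_head _ _ x h
    | crossing s =>
      match x with
      | [] | [_] | [_, _] => rfl
      | l :: t :: r :: z =>
        exact sum_congr rfl fun b _ => congrArg _ (h _ rfl)
  | succ a =>
    cases x with
    | nil => rfl
    | cons c x =>
      rw [layerOp_succ, layerOp_succ]
      exact congrArg (fun f => M.layerOp a p f x) (funext fun y => h _ rfl)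

theorem vertexOp_congr (M : ColourWeights C K) (p q b : ℕ) {f g : List C → K} {x : List C}
    (hx : x.IsChain (· ≠ ·)) (hl : x.length = p + b + 1)
    (h : ∀ y : List C, y.IsChain (· ≠ ·) → y.head? = x.head? → y.length = q + b + 1 → f y = g y) :
    M.vertexOp p q f x = M.vertexOp p q g x := by
  cases x with
  | nil => rfl
  | cons l x =>
    rw [vertexOp_cons, vertexOp_cons, pathSum_congr _ _ (hx.drop p)]
    intro y hy hyl hyn
    refine h y hy hyl ?_
    rw [hyn, List.length_drop, hl]
    omega

/-- Layers act on functions of lists without repeated neighbours. -/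
theorem layerOp_congr (M : ColourWeights C K) (a b : ℕ) (p : Piece) {f g : List C → K} {x : List C}
    (hx : x.IsChain (· ≠ ·)) (hl : x.length = a + p.top + b + 1)
    (h : ∀ y : List C, y.IsChain (· ≠ ·) → y.head? = x.head? → y.length = a + p.bot + b + 1 →
      f y = g y) :
    M.layerOp a p f x = M.layerOp a p g x := by
  induction a generalizing f g x with
  | zero =>
    rw [Nat.zero_add] at hl h
    cases p with
    | cap | cup | vertex p q => exact M.vertexOp_congr _ _ b hx hl h
    | crossing s =>
      match x, hx with
      | [], _ | [_], _ | [_, _], _ => rfl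
      | l :: t :: r :: z, hx =>
        refine sum_congr rfl fun b hb => ?_
        refine congrArg _ (h _ ?_ rfl hl)
        simp only [List.isChain_cons_cons, mem_filter] at hx hb ⊢
        exact ⟨hb.2.1.symm, hb.2.2, hx.2.2⟩
  | succ a ih =>
    cases x with
    | nil => rfl
    | cons c x =>
      rw [layerOp_succ, layerOp_succ]
      rw [List.length_cons] at hl
      rw [List.isChain_cons] at hx
      refine ih hx.2 (by omega) fun y hy hyx hyl => h _ ?_ rfl (by rw [List.length_cons]; omega)
      rw [List.isChain_cons, hyx]
      exact ⟨hx.1, hy⟩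

theorem wordOp_congr (M : ColourWeights C K) {n m : ℕ} {w : List Layer} (hw : IsDiagram n w m)
    {f g : List C → K} {x : List C} (hx : x.IsChain (· ≠ ·)) (hl : x.length = n + 1)
    (h : ∀ y : List C, y.IsChain (· ≠ ·) → y.length = m + 1 → f y = g y) :
    M.wordOp w f x = M.wordOp w g x := by
  induction hw generalizing x with
  | nil n => exact h x hx hl
  | cons a b p w m _ ih =>
    exact M.layerOp_congr a b p hx hl fun y hy _ hyl => ih hy hyl h

/-! ### Invariance under moves -/

/-- The words `w` and `w'` with `n` upper endpoints act in the same way. -/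
def SameOp (M : ColourWeights C K) (n : ℕ) (w w' : List Layer) : Prop :=
  ∀ (f : List C → K) (x : List C), x.IsChain (· ≠ ·) → x.length = n + 1 →
    M.wordOp w f x = M.wordOp w' f x

/-- A layer with one more strand on the left. -/
def _root_.Layer.shift (l : Layer) : Layer := ⟨l.left + 1, l.piece⟩

theorem wordOp_shift (M : ColourWeights C K) (w : List Layer) (f : List C → K) (c : C)
    (x : List C) : M.wordOp (w.map Layer.shift) f (c :: x) =
      M.wordOp w (fun y => f (c :: y)) x := by
  induction w generalizing x with
  | nil => rfl
  | cons l w ih =>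
    change M.layerOp l.left l.piece (fun y => M.wordOp (w.map Layer.shift) f (c :: y)) x = _
    rw [funext ih]
    rfl

theorem SameOp.shift {M : ColourWeights C K} {n : ℕ} {w w' : List Layer} (h : M.SameOp n w w') :
    M.SameOp (n + 1) (w.map Layer.shift) (w'.map Layer.shift) := by
  intro f x hx hl
  cases x with
  | nil => simp at hl
  | cons c x =>
    rw [wordOp_shift, wordOp_shift]
    exact h _ x hx.of_cons (by simpa using hl)

theorem SameOp.shift_iterate {M : ColourWeights C K} {n : ℕ} {w w' : List Layer}
    (h : M.SameOp n w w') (a : ℕ) :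
    M.SameOp (n + a) (w.map fun l => ⟨a + l.left, l.piece⟩)
      (w'.map fun l => ⟨a + l.left, l.piece⟩) := by
  induction a with
  | zero => simpa using h
  | succ a ih =>
    have e : (fun l : Layer => (⟨a + 1 + l.left, l.piece⟩ : Layer)) =
        Layer.shift ∘ fun l => ⟨a + l.left, l.piece⟩ := by
      funext l
      simp only [Function.comp, Layer.shift, Layer.mk.injEq, and_true]
      omega
    rw [e, ← List.map_map, ← List.map_map]
    exact ih.shift

/-- The crossing weights as a connection: `T x x' y y'` is the amplitude for the colour `y` to become
`y'` on one side of a strand when `x` becomes `x'` on its other side. -/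
def transport (M : ColourWeights C K) (x x' y y' : C) : K :=
  if x = x' then if y = y' then 1 else 0
  else if y = y' then 0 else M.crossingWeight y y' x x'

theorem transport_swap (M : ColourWeights C K) (x x' y y' : C) :
    M.swap.transport y y' x x' = M.transport x x' y y' := by
  unfold transport crossingWeight swap
  by_cases h₁ : x = x' <;> by_cases h₂ : y = y' <;> simp only [h₁, h₂, if_true, if_false]
  rw [add_comm (ite _ _ _), if_congr (eq_comm (a := x)) rfl rfl]
  simp only [eq_comm]

/-- The connection is flat. This identity is behind all moves in which a strand passes over or under
something else. -/
theorem sum_transport_mul_transport (M : ColourWeights C K) {x x' x'' y y'' : C} (h : x ≠ y)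
    (h'' : x'' ≠ y'') :
    ∑ y' with y' ≠ x', M.transport x x' y y' * M.transport x' x'' y' y'' =
      M.transport x x'' y y'' := by
  by_cases h₁ : x = x'
  · subst h₁
    rw [sum_eq_single y]
    · simp [transport]
    · intro z _ hz
      simp [transport, hz.symm]
    · simp [h.symm]
  by_cases h₂ : x' = x''
  · subst h₂
    rw [sum_eq_single y'']
    · simp [transport]
    · intro z _ hz
      simp [transport, hz]
    · simp [h''.symm]
  have e : ∑ y' with y' ≠ x', M.transport x x' y y' * M.transport x' x'' y' y'' =
      ∑ y' ∈ ({x', y, y''} : Finset C)ᶜ,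
        ((if y' = x then M.B else 0) + ((if y = x' then M.B' else 0) - 1)) *
          (((if y'' = x' then M.B else 0) - 1) + (if y' = x'' then M.B' else 0)) := by
    symm
    refine sum_subset_zero_on_sdiff (fun z hz => by simp_all) (fun z hz => ?_) fun z hz => ?_
    · simp only [mem_sdiff, mem_filter, mem_univ, true_and, mem_compl, mem_insert,
        mem_singleton, not_not] at hz
      obtain rfl | rfl : z = y ∨ z = y'' := by tauto
      · simp [transport, h₁]
      · simp [transport, h₂]
    · simp only [mem_compl, mem_insert, mem_singleton, not_or] at hz
      simp only [transport, h₁, h₂, Ne.symm hz.2.1, hz.2.2, if_false, crossingWeight]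
      ring
  rw [e, sum_mul_sum_indicator, card_compl, Nat.cast_sub (card_le_univ _), M.card_eq]
  have h0 : M.B ≠ 0 := left_ne_zero_of_mul_eq_one M.mul_eq_one
  have h0' : M.B' = M.B⁻¹ := eq_inv_of_mul_eq_one_right M.mul_eq_one
  clear e
  have hx : x ∈ ({x', y, y''} : Finset C)ᶜ ↔ x ≠ y'' := by simp [h, h₁]
  have hx'' : x'' ∈ ({x', y, y''} : Finset C)ᶜ ↔ x'' ≠ y := by simp [h'', Ne.symm h₂]
  simp only [hx, hx'']
  clear hx hx''
  have dich (a b : C) : a = b ∨ a ≠ b ∧ b ≠ a := (eq_or_ne a b).imp_right fun h => ⟨h, h.symm⟩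
  by_cases h₃ : y = y''
  · subst h₃
    by_cases h₄ : y = x'
    · subst h₄
      by_cases h₅ : x = x'' <;> simp [transport, h, h'', h₅, h0'] <;> field_simp <;> ring
    · have hc : #{x', y} = 2 := card_pair (Ne.symm h₄)
      by_cases h₅ : x = x'' <;> simp [transport, h, h'', h₅, h0', h₄, hc] <;> field_simp <;> ring
  · by_cases h₄ : y = x'
    · subst h₄
      have hc : #{y, y''} = 2 := card_pair h₃
      by_cases h₅ : x = x''
      · subst h₅
        simp [transport, h'', h, h0', h₃, Ne.symm h₃, hc]
        field_simp
        ring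
      · obtain rfl | ⟨h₆, h₆'⟩ := dich x y'' <;>
        simp [transport, crossingWeight, h''.symm, Ne.symm h₂, Ne.symm h₃, *] <;> field_simp <;> ring
    by_cases h₇ : y'' = x'
    · subst h₇
      have hc : #{y'', y} = 2 := card_pair (Ne.symm h₃)
      by_cases h₅ : x = x''
      · subst h₅
        simp [transport, h'', h, h0', h₃]
        field_simp
        ring
      · obtain rfl | ⟨h₆, h₆'⟩ := dich x'' y <;>
        simp [transport, crossingWeight, Ne.symm h₁, Ne.symm h₃, *] <;> field_simp <;> ring
    · have hc : #{x', y, y''} = 3 :=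
        card_eq_three.2 ⟨_, _, _, Ne.symm h₄, Ne.symm h₇, h₃, rfl⟩
      by_cases h₅ : x = x''
      · subst h₅
        simp [transport, h'', h, h0', h₃, h₄, h₇, hc]
        field_simp
        ring
      · obtain rfl | ⟨h₆, h₆'⟩ := dich x'' y <;> obtain rfl | ⟨h₈, h₈'⟩ := dich x y'' <;>
        simp [transport, crossingWeight, h.symm, h''.symm, *] <;> field_simp <;> ring

theorem pathSum_layerOp (M : ColourWeights C K) (q c : ℕ) (p : Piece) (l : C) (f : List C → K)
    (x : List C) :
    pathSum q l (M.layerOp (q + c) p f) x = M.layerOp c p (pathSum q l f) x := by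
  induction q generalizing l f with
  | zero =>
    rw [Nat.zero_add]
    simp only [pathSum, LinearMap.coe_mk, AddHom.coe_mk]
    split_ifs with hx
    · exact M.layerOp_congr_head c p x fun y hy => (if_pos (hy.trans hx)).symm
    · have h := M.layerOp_congr_head c p x (f := 0) (g := pathSum 0 l f)
        fun y hy => (if_neg (by rwa [hy])).symm
      rw [map_zero] at h
      exact h
  | succ q ih =>
    have h : pathSum (q + 1) l f = ∑ m with m ≠ l, pathSum q m (fun y => f (l :: y)) := by
      ext x
      rw [pathSum_succ, Finset.sum_apply]
    rw [h, map_sum, Finset.sum_apply, pathSum_succ]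
    refine sum_congr rfl fun m _ => ?_
    rw [← ih, Nat.add_right_comm]
    rfl

theorem vertexOp_exchange (M : ColourWeights C K) (p q c : ℕ) (P : Piece) (f : List C → K)
    (x : List C) (hx : p < x.length) :
    M.vertexOp p q (M.layerOp (q + c) P f) x = M.layerOp (p + c) P (M.vertexOp p q f) x := by
  obtain ⟨u, z, rfl, rfl⟩ : ∃ u z, x = u ++ z ∧ u.length = p :=
    ⟨x.take p, x.drop p, by simp, by simp; omega⟩
  obtain ⟨l, hl⟩ : ∃ l, (u ++ z).head? = some l := by
    cases h : u ++ z with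
    | nil => simp_all
    | cons l y => exact ⟨l, rfl⟩
  have h := M.layerOp_congr_head c P z (f := (M.δ ^ (1 - q : ℤ)) • pathSum q l f)
    (g := fun y => M.vertexOp u.length q f (u ++ y)) fun y hy =>
      (M.vertexOp_append _ q f l u y rfl
        (by rw [← hl, List.head?_append, List.head?_append, hy])).symm
  rw [map_smul] at h
  rw [M.vertexOp_append _ q _ l u z rfl hl, pathSum_layerOp, layerOp_append, ← h]
  rfl

theorem crossingOp_exchange (M M' : ColourWeights C K) (c : ℕ) (P : Piece) (f : List C → K)
    (x : List C) (hx : 2 < x.length) :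
    M'.crossingOp (M.layerOp (2 + c) P f) x = M.layerOp (2 + c) P (M'.crossingOp f) x := by
  match x with
  | [] | [_] | [_, _] => simp at hx
  | l :: t :: r :: z =>
    have e (b : C) : M.layerOp (2 + c) P f (l :: b :: r :: z) =
        M.layerOp c P (fun y => f (l :: b :: y)) (r :: z) := M.layerOp_append c P f [l, b] _
    have e' : M.layerOp (2 + c) P (M'.crossingOp f) (l :: t :: r :: z) =
        M.layerOp c P (fun y => M'.crossingOp f (l :: t :: y)) (r :: z) :=
      M.layerOp_append c P _ [l, t] _
    rw [crossingOp_cons, e', M.layerOp_congr_head c P (r :: z) (g := ∑ b with b ≠ l ∧ b ≠ r,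
      M'.crossingWeight l t b r • fun y => f (l :: b :: y)), map_sum, Finset.sum_apply]
    · refine sum_congr rfl fun b _ => ?_
      rw [map_smul, e]
      rfl
    · intro y hy
      cases y with
      | nil => simp at hy
      | cons s y =>
        obtain rfl : s = r := by simpa using hy
        rw [crossingOp_cons, Finset.sum_apply]
        rfl

theorem sameOp_exchange (M : ColourWeights C K) {n : ℕ} (c : ℕ) (p q : Piece) (hn : p.top ≤ n) :
    M.SameOp n [⟨0, p⟩, ⟨p.bot + c, q⟩] [⟨p.top + c, q⟩, ⟨0, p⟩] := by
  intro f x _ hl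
  change M.pieceOp p (M.layerOp (p.bot + c) q f) x = M.layerOp (p.top + c) q (M.pieceOp p f) x
  cases p with
  | cap => exact M.vertexOp_exchange 0 2 c q f x (by omega)
  | cup => exact M.vertexOp_exchange 2 0 c q f x (by simp only [Piece.top] at hn; omega)
  | vertex i j => exact M.vertexOp_exchange i j c q f x (by simp only [Piece.top] at hn; omega)
  | crossing s =>
    exact M.crossingOp_exchange _ c q f x (by simp only [Piece.top] at hn; omega)

theorem sameOp_zigzag_left (M : ColourWeights C K) (n : ℕ) (hn : 1 ≤ n) :
    M.SameOp n [⟨1, .cap⟩, ⟨0, .cup⟩] [] := by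
  intro f x hx hl
  match x, hx with
  | [], _ | [_], _ => simp at hl; try omega
  | l :: r :: z, hx =>
    change M.pieceOp .cap (fun y => M.pieceOp .cup f (l :: y)) (r :: z) = f (l :: r :: z)
    simp only [capOp_cons, cupOp_cons, sum_filter]
    rw [sum_eq_single l]
    · simp [(List.isChain_cons_cons.1 hx).1, M.ne_zero]
    · intro b _ hb
      simp [hb]
    · simp

theorem sameOp_zigzag_right (M : ColourWeights C K) (n : ℕ) (hn : 1 ≤ n) :
    M.SameOp n [⟨0, .cap⟩, ⟨1, .cup⟩] [] := by
  intro f x hx hl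
  match x, hx with
  | [], _ | [_], _ => simp at hl; try omega
  | l :: r :: z, hx =>
    change M.pieceOp .cap (M.layerOp 1 .cup f) (l :: r :: z) = f (l :: r :: z)
    have e (m : C) : M.layerOp 1 .cup f (l :: m :: l :: r :: z) =
        if r = m then M.δ * f (l :: r :: z) else 0 := M.cupOp_cons _ m l r z
    simp only [capOp_cons, e, sum_filter]
    rw [sum_eq_single r]
    · simp [(List.isChain_cons_cons.1 hx).1.symm, M.ne_zero]
    · intro b _ hb
      simp [hb.symm]
    · simp

theorem crossingWeight_swap (M : ColourWeights C K) (l t b r : C) :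
    M.swap.crossingWeight t l r b = M.crossingWeight l t b r := by
  simp only [crossingWeight, swap, add_comm]

theorem crossingWeight_comm (M : ColourWeights C K) (l t b r : C) :
    M.crossingWeight l t b r = M.crossingWeight l b t r := by
  simp only [crossingWeight, eq_comm]

theorem sameOp_turn_crossing (M : ColourWeights C K) (n : ℕ) (s : Bool) (hn : 2 ≤ n) :
    M.SameOp n [⟨0, .cap⟩, ⟨1, .crossing s⟩, ⟨2, .cup⟩] [⟨0, .crossing !s⟩] := by
  intro f x hx hl
  match x, hx with
  | [], _ | [_], _ | [_, _], _ => simp at hl; try omega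
  | l :: t :: r :: z, hx =>
    simp only [List.isChain_cons_cons] at hx
    change M.pieceOp .cap (M.layerOp 1 (.crossing s) (M.layerOp 2 .cup f)) (l :: t :: r :: z) =
      (M.ofSign !s).crossingOp f (l :: t :: r :: z)
    have e (m : C) : M.layerOp 1 (.crossing s) (M.layerOp 2 .cup f) (l :: m :: l :: t :: r :: z) =
        ∑ b with b ≠ m ∧ b ≠ t, (M.ofSign s).crossingWeight m l b t *
          if r = b then M.δ * f (l :: m :: r :: z) else 0 :=
      ((M.ofSign s).crossingOp_cons _ m l t (r :: z)).trans
        (sum_congr rfl fun b _ => congrArg _ (M.cupOp_cons (fun y => f (l :: m :: y)) b t r z))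
    have e' (m : C) : M.layerOp 1 (.crossing s) (M.layerOp 2 .cup f) (l :: m :: l :: t :: r :: z) =
        if r = m then 0 else
          (M.ofSign s).crossingWeight m l r t * (M.δ * f (l :: m :: r :: z)) := by
      rw [e, sum_filter, sum_eq_single r]
      · simp [hx.2.1.symm, ite_not]
      · intro b _ hb
        simp [hb.symm]
      · simp
    rw [capOp_cons, crossingOp_cons, mul_sum, ofSign_not, sum_filter, sum_filter]
    refine sum_congr rfl fun m _ => ?_
    rw [e']
    have e₂ : (M.ofSign s).swap.crossingWeight l t m r = (M.ofSign s).crossingWeight m l r t := by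
      simp only [crossingWeight, swap, eq_comm (a := t)]
      ring
    have hd := M.ne_zero
    obtain rfl | h' := eq_or_ne r m
    · simp
    · by_cases h : m = l <;> simp [h, h', e₂, h'.symm]
      field_simp

theorem sameOp_turn_vertex_left (M : ColourWeights C K) (n p q : ℕ) :
    M.SameOp n [⟨0, .cap⟩, ⟨1, .vertex (p + 1) q⟩] [⟨0, .vertex p (q + 1)⟩] := by
  intro f x hx hl
  match x, hx with
  | [], _ => simp at hl
  | l :: x, hx =>
    change M.pieceOp .cap (M.layerOp 1 (.vertex (p + 1) q) f) (l :: x) =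
      M.vertexOp p (q + 1) f (l :: x)
    have e (m : C) : M.layerOp 1 (.vertex (p + 1) q) f (l :: m :: l :: x) =
        M.δ ^ (1 - q : ℤ) * pathSum q m (fun y => f (l :: y)) ((l :: x).drop p) := rfl
    have e₂ : M.δ ^ (1 - (q + 1 : ℕ) : ℤ) = M.δ⁻¹ * M.δ ^ (1 - q : ℤ) := by
      rw [← zpow_neg_one, ← zpow_add₀ M.ne_zero]
      congr 1
      push_cast
      ring
    simp only [capOp_cons, vertexOp_cons, e, e₂, pathSum_succ, mul_sum, mul_assoc]

theorem sameOp_turn_vertex_right (M : ColourWeights C K) (n p q : ℕ) (hn : p ≤ n) :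
    M.SameOp n [⟨p, .cap⟩, ⟨0, .vertex (p + 1) q⟩] [⟨0, .vertex p (q + 1)⟩] := by
  intro f x hx hl
  obtain ⟨u, z, rfl, rfl⟩ : ∃ u z, x = u ++ z ∧ u.length = p :=
    ⟨x.take p, x.drop p, by simp, by simp; omega⟩
  match z with
  | [] => simp at hl; omega
  | r :: z =>
    obtain ⟨l, hl⟩ : ∃ l, (u ++ [r]).head? = some l := by
      cases u with
      | nil => exact ⟨r, rfl⟩
      | cons l y => exact ⟨l, rfl⟩
    have hl' : ∀ y, (u ++ r :: y).head? = some l := by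
      intro y
      rw [← hl, List.head?_append, List.head?_append]
      rfl
    change M.layerOp u.length .cap (M.vertexOp (u.length + 1) q f) (u ++ r :: z) =
      M.vertexOp u.length (q + 1) f (u ++ r :: z)
    have e : M.layerOp u.length .cap (M.vertexOp (u.length + 1) q f) (u ++ r :: z) =
        M.pieceOp .cap (fun y => M.vertexOp (u.length + 1) q f (u ++ y)) (r :: z) :=
      M.layerOp_append 0 .cap _ u (r :: z)
    have e₁ (m : C) : M.vertexOp (u.length + 1) q f (u ++ r :: m :: r :: z) =
        M.δ ^ (1 - q : ℤ) * pathSum q l f (m :: r :: z) := by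
      have := M.vertexOp_append (u.length + 1) q f l (u ++ [r]) (m :: r :: z) (by simp)
        (by simpa using hl' (m :: r :: z))
      simpa using this
    have e₂ : M.δ ^ (1 - (q + 1 : ℕ) : ℤ) = M.δ⁻¹ * M.δ ^ (1 - q : ℤ) := by
      rw [← zpow_neg_one, ← zpow_add₀ M.ne_zero]
      congr 1
      push_cast
      ring
    rw [e, capOp_cons, M.vertexOp_append _ _ f l u (r :: z) rfl (hl' z), e₂, pathSum_succ_last]
    simp only [e₁, mul_sum, mul_assoc]

theorem card_filter_ne (M : ColourWeights C K) (c : C) :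
    (#{m | m ≠ c} : K) = M.B + 1 + M.B' := by
  rw [filter_ne', card_erase_of_mem (mem_univ c), card_univ, Nat.cast_sub (Fintype.card_pos_iff.2 ⟨c⟩),
    M.card_eq]
  push_cast
  ring

theorem sameOp_curl (M : ColourWeights C K) (n : ℕ) (s : Bool) (hn : 1 ≤ n) :
    M.SameOp n [⟨1, .cap⟩, ⟨0, .crossing s⟩, ⟨1, .cup⟩]
      [⟨0, .cap⟩, ⟨1, .crossing s⟩, ⟨0, .cup⟩] := by
  intro f x hx hl
  match x, hx with
  | [], _ | [_], _ => simp at hl; try omega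
  | l :: r :: z, hx =>
    have hlr := (List.isChain_cons_cons.1 hx).1
    change M.pieceOp .cap (fun y => (M.ofSign s).crossingOp (M.layerOp 1 .cup f) (l :: y)) (r :: z) =
      M.pieceOp .cap (M.layerOp 1 (.crossing s) (M.pieceOp .cup f)) (l :: r :: z)
    have e₁ (m : C) : (M.ofSign s).crossingOp (M.layerOp 1 .cup f) (l :: r :: m :: r :: z) =
        if m = r then 0 else
          (M.ofSign s).crossingWeight l r r m * (M.δ * f (l :: r :: z)) := by
      have e (b : C) : M.layerOp 1 .cup f (l :: b :: m :: r :: z) =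
          if r = b then M.δ * f (l :: r :: z) else 0 := M.cupOp_cons _ b m r z
      rw [crossingOp_cons, sum_filter, sum_eq_single r]
      · simp [hlr.symm, e, ite_not, eq_comm]
      · intro b _ hb
        simp [e, hb.symm]
      · simp
    have e₂ (m : C) : M.layerOp 1 (.crossing s) (M.pieceOp .cup f) (l :: m :: l :: r :: z) =
        if m = l then 0 else
          (M.ofSign s).crossingWeight m l l r * (M.δ * f (l :: r :: z)) := by
      have e (b : C) : M.pieceOp .cup f (l :: m :: b :: r :: z) =
          if b = l then M.δ * f (b :: r :: z) else 0 := M.cupOp_cons _ l m b (r :: z)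
      have e' : M.layerOp 1 (.crossing s) (M.pieceOp .cup f) (l :: m :: l :: r :: z) =
          ∑ b with b ≠ m ∧ b ≠ r, (M.ofSign s).crossingWeight m l b r *
            M.pieceOp .cup f (l :: m :: b :: r :: z) := rfl
      rw [e', sum_filter, sum_eq_single l]
      · simp [hlr, e, ite_not, eq_comm]
      · intro b _ hb
        simp [e, hb]
      · simp
    have key : ∑ m with m ≠ r, (M.ofSign s).crossingWeight l r r m =
        ∑ m with m ≠ l, (M.ofSign s).crossingWeight m l l r := by
      simp only [crossingWeight, sum_sub_distrib, sum_add_distrib, if_true, sum_const,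
        nsmul_eq_mul, sum_ite_eq, sum_ite_eq', M.card_filter_ne]
      simp [hlr, hlr.symm]
    rw [capOp_cons, capOp_cons]
    congr 1
    calc _ = ∑ m with m ≠ r, (M.ofSign s).crossingWeight l r r m * (M.δ * f (l :: r :: z)) :=
          sum_congr rfl fun m hm => by rw [e₁, if_neg (mem_filter.1 hm).2]
      _ = ∑ m with m ≠ l, (M.ofSign s).crossingWeight m l l r * (M.δ * f (l :: r :: z)) := by
          rw [← sum_mul, key, sum_mul]
      _ = _ := sum_congr rfl fun m hm => by rw [e₂, if_neg (mem_filter.1 hm).2]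

theorem transport_of_ne (M : ColourWeights C K) {x x' y y' : C} (hx : x ≠ x') (hy : y ≠ y') :
    M.transport x x' y y' = M.crossingWeight y y' x x' := by
  rw [transport, if_neg hx, if_neg hy]

/-- Flatness of the connection in the other direction. -/
theorem sum_transport_mul_transport' (M : ColourWeights C K) {x x'' y y' y'' : C} (h : x ≠ y)
    (h'' : x'' ≠ y'') :
    ∑ x' with x' ≠ y', M.transport x x' y y' * M.transport x' x'' y' y'' =
      M.transport x x'' y y'' := by
  have := M.swap.sum_transport_mul_transport (x := y) (x' := y') (x'' := y'') (y := x) (y'' := x'')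
    h.symm h''.symm
  simpa only [transport_swap] using this

theorem sameOp_cancel (M : ColourWeights C K) (n : ℕ) (s : Bool) (hn : 2 ≤ n) :
    M.SameOp n [⟨0, .crossing s⟩, ⟨0, .crossing !s⟩] [] := by
  intro f x hx hl
  match x, hx with
  | [], _ | [_], _ | [_, _], _ => simp at hl; try omega
  | l :: t :: r :: z, hx =>
    simp only [List.isChain_cons_cons] at hx
    change (M.ofSign s).crossingOp ((M.ofSign !s).crossingOp f) (l :: t :: r :: z) = _
    rw [ofSign_not]
    generalize M.ofSign s = M
    have key (c : C) (hc : c ≠ l ∧ c ≠ r) : ∑ b with b ≠ l ∧ b ≠ r, M.crossingWeight l t b r *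
        M.swap.crossingWeight l b c r = if t = c then 1 else 0 := by
      have h := M.swap.sum_transport_mul_transport' (x := r) (x'' := r) (y := t) (y' := l)
        (y'' := c) hx.2.1.symm hc.2.symm
      rw [transport, if_pos rfl] at h
      rw [← h, filter_and, inter_comm, ← filter_and]
      symm
      rw [sum_filter, sum_filter]
      refine sum_congr rfl fun b _ => ?_
      obtain rfl | hb := eq_or_ne b r
      · simp [transport, hx.1.symm]
      · rw [transport_of_ne _ hb.symm hx.1.symm, transport_of_ne _ hb hc.1.symm,
          crossingWeight_swap, crossingWeight_comm _ l c]
        simp [hb]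
    simp only [crossingOp_cons, mul_sum]
    rw [sum_comm]
    calc _ = ∑ c with c ≠ l ∧ c ≠ r, (if t = c then 1 else 0) * f (l :: c :: r :: z) := by
          refine sum_congr rfl fun c hc => ?_
          rw [← key c (mem_filter.1 hc).2, sum_mul]
          simp only [mul_assoc]
      _ = f (l :: t :: r :: z) := by
          rw [sum_eq_single t]
          · simp
          · intro b _ hb
            simp [hb.symm]
          · intro h
            simp [hx.1.symm, hx.2.1] at h

theorem sameOp_braid (M : ColourWeights C K) (n : ℕ) (s : Bool) (hn : 3 ≤ n) :
    M.SameOp n [⟨0, .crossing s⟩, ⟨1, .crossing s⟩, ⟨0, .crossing s⟩]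
      [⟨1, .crossing s⟩, ⟨0, .crossing s⟩, ⟨1, .crossing s⟩] := by
  intro f x hx hl
  match x, hx with
  | [], _ | [_], _ | [_, _], _ | [_, _, _], _ => simp at hl; try omega
  | l :: t₁ :: t₂ :: r :: z, hx =>
    simp only [List.isChain_cons_cons] at hx
    change (M.ofSign s).crossingOp (M.layerOp 1 (.crossing s) ((M.ofSign s).crossingOp f))
        (l :: t₁ :: t₂ :: r :: z) =
      M.layerOp 1 (.crossing s) ((M.ofSign s).crossingOp (M.layerOp 1 (.crossing s) f))
        (l :: t₁ :: t₂ :: r :: z)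
    have e (g : List C → K) (u v w : C) : M.layerOp 1 (.crossing s) g (u :: v :: w :: r :: z) =
        ∑ b with b ≠ v ∧ b ≠ r, (M.ofSign s).crossingWeight v w b r * g (u :: v :: b :: r :: z) :=
      rfl
    simp only [crossingOp_cons, e]
    clear e
    generalize M.ofSign s = M
    obtain ⟨h₁, h₂, h₃, -⟩ := hx
    -- One of the three crossings is between the two strands that the third one passes. Its first
    -- term lets these strands run in parallel, and in the others the flatness applies.
    have hL (b₁ b₂ : C) (hb₁ : b₁ ≠ l) (hb : b₂ ≠ b₁) (hb₂ : b₂ ≠ r) :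
        ∑ m with (m ≠ l ∧ m ≠ t₂) ∧ m ≠ b₂, M.crossingWeight l t₁ m t₂ *
          (M.crossingWeight m t₂ b₂ r * M.crossingWeight l m b₁ b₂) =
        (if t₁ = b₂ then 0 else M.B * (M.crossingWeight t₁ t₂ b₂ r * M.crossingWeight l t₁ b₁ b₂))
          + ((if l = t₂ then M.B' else 0) - 1) * M.transport b₁ r l t₂ := by
      rw [← M.sum_transport_mul_transport (x' := b₂) hb₁ h₃.symm, mul_sum]
      have e : (if t₁ = b₂ then 0 else
          M.B * (M.crossingWeight t₁ t₂ b₂ r * M.crossingWeight l t₁ b₁ b₂)) =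
          ∑ m, if m = t₁ then if t₁ = b₂ then 0 else
            M.B * (M.crossingWeight t₁ t₂ b₂ r * M.crossingWeight l t₁ b₁ b₂) else 0 := by simp
      rw [e, sum_filter, sum_filter, ← sum_add_distrib]
      refine sum_congr rfl fun m _ => ?_
      by_cases hm : m = b₂
      · by_cases ht : m = t₁
        · subst ht; simp [hm]
        · subst hm; simp [ht]
      by_cases hml : m = l
      · simp [transport, hml, hb.symm, h₁]
      by_cases hmt : m = t₂
      · simp [transport, hmt, hb₂, h₂.symm]
      rw [transport_of_ne _ hb.symm (Ne.symm hml), transport_of_ne _ hb₂ hmt]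
      by_cases ht : m = t₁
      · subst ht
        simp only [hm, hml, hmt, crossingWeight, ne_eq, not_false_eq_true, and_self, if_true,
          if_false]
        ring
      · simp only [hm, hml, hmt, ht, Ne.symm ht, crossingWeight, ne_eq, not_false_eq_true,
          and_self, if_true, if_false]
        ring
    have hR (b₁ b₂ : C) (hb₁ : b₁ ≠ l) (hb : b₂ ≠ b₁) (hb₂ : b₂ ≠ r) :
        ∑ m with (m ≠ t₁ ∧ m ≠ r) ∧ m ≠ b₁, M.crossingWeight t₁ t₂ m r *
          (M.crossingWeight l t₁ b₁ m * M.crossingWeight b₁ m b₂ r) =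
        (if t₁ = b₂ then 0 else M.B * (M.crossingWeight t₁ t₂ b₂ r * M.crossingWeight l t₁ b₁ b₂))
          + ((if b₁ = r then M.B' else 0) - 1) * M.transport b₁ r l t₂ := by
      rw [← M.sum_transport_mul_transport' (y' := t₁) hb₁ h₃.symm, mul_sum]
      have e : (if t₁ = b₂ then 0 else
          M.B * (M.crossingWeight t₁ t₂ b₂ r * M.crossingWeight l t₁ b₁ b₂)) =
          ∑ m, if m = b₂ then if t₁ = b₂ then 0 else
            M.B * (M.crossingWeight t₁ t₂ b₂ r * M.crossingWeight l t₁ b₁ b₂) else 0 := by simp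
      rw [e, sum_filter, sum_filter, ← sum_add_distrib]
      refine sum_congr rfl fun m _ => ?_
      by_cases hm : m = t₁
      · subst hm
        by_cases ht : m = b₂ <;> simp [ht]
      by_cases hmr : m = r
      · subst hmr
        simp [transport, h₂, hb₂.symm]
      by_cases hmb : m = b₁
      · subst hmb
        simp [transport, h₁, hb.symm]
      rw [transport_of_ne _ (Ne.symm hmb) h₁, transport_of_ne _ hmr h₂]
      by_cases ht : m = b₂
      · subst ht
        simp only [hm, Ne.symm hm, hmr, hmb, crossingWeight, ne_eq, not_false_eq_true, and_self,
          if_true, if_false]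
        ring
      · simp only [hm, hmr, hmb, ht, crossingWeight, ne_eq, not_false_eq_true,
          and_self, if_true, if_false]
        ring
    have hLR (b₁ : C) : ((if l = t₂ then M.B' else 0) - 1) * M.transport b₁ r l t₂ =
        ((if b₁ = r then M.B' else 0) - 1) * M.transport b₁ r l t₂ := by
      by_cases h : l = t₂ <;> by_cases h' : b₁ = r <;> simp [transport, h, h']
    have hfil (p : C → Prop) [DecidablePred p] (g : C → K) :
        ∑ m with p m, g m = ∑ m, (if p m then 1 else 0) * g m := by
      simp [sum_filter]
    calc _ = ∑ b₁, ∑ b₂, (if b₁ ≠ l ∧ b₂ ≠ b₁ ∧ b₂ ≠ r then 1 else 0) *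
          ((∑ m with (m ≠ l ∧ m ≠ t₂) ∧ m ≠ b₂, M.crossingWeight l t₁ m t₂ *
          (M.crossingWeight m t₂ b₂ r * M.crossingWeight l m b₁ b₂)) *
            f (l :: b₁ :: b₂ :: r :: z)) := by
          simp only [hfil, mul_sum, sum_mul]
          rw [sum_comm, sum_congr rfl fun _ _ => sum_comm, sum_comm]
          refine sum_congr rfl fun b₁ _ => sum_congr rfl fun b₂ _ => sum_congr rfl fun m _ => ?_
          have e₁ : b₂ = m ↔ m = b₂ := eq_comm
          have e₂ : b₁ = b₂ ↔ b₂ = b₁ := eq_comm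
          by_cases c₁ : m = b₂ <;> by_cases c₂ : b₂ = b₁ <;> simp [e₁, e₂, c₁, c₂]
          split_ifs <;> simp_all
          ring
      _ = ∑ b₁, ∑ b₂, (if b₁ ≠ l ∧ b₂ ≠ b₁ ∧ b₂ ≠ r then 1 else 0) *
          ((∑ m with (m ≠ t₁ ∧ m ≠ r) ∧ m ≠ b₁, M.crossingWeight t₁ t₂ m r *
          (M.crossingWeight l t₁ b₁ m * M.crossingWeight b₁ m b₂ r)) *
            f (l :: b₁ :: b₂ :: r :: z)) := by
          refine sum_congr rfl fun b₁ _ => sum_congr rfl fun b₂ _ => ?_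
          split_ifs with h
          · rw [hL b₁ b₂ h.1 h.2.1 h.2.2, hR b₁ b₂ h.1 h.2.1 h.2.2, hLR]
          · simp
      _ = _ := by
          simp only [hfil, mul_sum, sum_mul]
          symm
          rw [sum_comm, sum_congr rfl fun _ _ => sum_comm]
          refine sum_congr rfl fun b₁ _ => sum_congr rfl fun b₂ _ => sum_congr rfl fun m _ => ?_
          have e₁ : b₁ = m ↔ m = b₁ := eq_comm
          by_cases c₁ : m = b₁ <;> by_cases c₂ : b₂ = b₁ <;> simp [e₁, c₁, c₂]
          split_ifs <;> simp_all
          ring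

theorem pathSum_crossingOp (M : ColourWeights C K) (k : ℕ) (x' y y' : C) (f : List C → K)
    (z : List C) :
    pathSum k x' (fun u => M.crossingOp f (y :: y' :: u)) z =
      ∑ x with x ≠ y ∧ x ≠ x', M.crossingWeight y y' x x' *
        pathSum k x' (fun u => f (y :: x :: u)) z := by
  rw [pathSum_congr_head k x' z (g := ∑ x with x ≠ y ∧ x ≠ x', M.crossingWeight y y' x x' •
    fun u => f (y :: x :: u)), map_sum, Finset.sum_apply]
  · simp only [map_smul]
    rfl
  · intro u hu
    cases u with
    | nil => simp at hu
    | cons c u =>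
      obtain rfl : c = x' := by simpa using hu
      rw [crossingOp_cons, Finset.sum_apply]
      rfl

/-- A strand between regions coloured `l` and `r` passes the `k` legs of a vertex. The region to the
left of the vertex has the colour `y`, and `x` is its colour on the other side of the strand. -/
theorem pathSum_slide (M : ColourWeights C K) (s : Bool) (k : ℕ) (y l r : C) (hlr : l ≠ r)
    (f : List C → K) (z : List C) :
    pathSum k y (M.wordOp ((List.range k).reverse.map fun i => ⟨i, .crossing s⟩) f)
      (l :: r :: z) =
    ∑ x with x ≠ y, (M.ofSign s).transport x r y l * pathSum k x (fun u => f (y :: u)) (r :: z) := by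
  induction k generalizing y f with
  | zero =>
    simp only [List.range_zero, List.reverse_nil, List.map_nil, wordOp, pathSum_zero,
      LinearMap.id_apply, sum_filter]
    rw [sum_eq_single r]
    · by_cases h : l = y
      · subst h; simp [transport, hlr.symm]
      · simp [transport, h, Ne.symm h]
    · intro x _ hx
      simp [hx.symm]
    · simp
  | succ k ih =>
    have e : (List.range (k + 1)).reverse.map (fun i => (⟨i, .crossing s⟩ : Layer)) =
        ((List.range k).reverse.map fun i => (⟨i, .crossing s⟩ : Layer)).map Layer.shift ++
          [⟨0, .crossing s⟩] := by
      rw [List.range_succ_eq_map]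
      simp [Layer.shift, Function.comp_def]
    have e' (y' : C) : pathSum k y' (fun u => M.wordOp ((List.range (k + 1)).reverse.map
        fun i => ⟨i, .crossing s⟩) f (y :: u)) (l :: r :: z) =
        ∑ x' with x' ≠ y', (M.ofSign s).transport x' r y' l *
          ∑ x with x ≠ y ∧ x ≠ x', (M.ofSign s).crossingWeight y y' x x' *
            pathSum k x' (fun u => f (y :: x :: u)) (r :: z) := by
      simp only [e, wordOp_append, wordOp_shift]
      rw [ih]
      refine sum_congr rfl fun x' _ => congrArg _ ?_
      exact (M.ofSign s).pathSum_crossingOp k x' y y' f (r :: z)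
    simp only [pathSum_succ, e']
    generalize M.ofSign s = M
    have hfil (p : C → Prop) [DecidablePred p] (g : C → K) :
        ∑ m with p m, g m = ∑ m, (if p m then 1 else 0) * g m := by
      simp [sum_filter]
    calc _ = ∑ x with x ≠ y, ∑ x' with x' ≠ x,
          (∑ y' with y' ≠ x', M.transport x x' y y' * M.transport x' r y' l) *
            pathSum k x' (fun u => f (y :: x :: u)) (r :: z) := by
          simp only [hfil, mul_sum, sum_mul]
          rw [sum_comm, sum_congr rfl fun _ _ => sum_comm, sum_comm]
          refine sum_congr rfl fun x _ => sum_congr rfl fun x' _ => sum_congr rfl fun y' _ => ?_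
          by_cases hx : x = x'
          · simp [hx]
          by_cases hy : y = y'
          · simp [hy, transport, hx]
          rw [M.transport_of_ne hx hy]
          simp only [Ne.symm hx, Ne.symm hy, hx, ne_eq, not_false_eq_true, if_true, and_true,
            eq_comm (a := y')]
          ring
      _ = _ := by
          refine sum_congr rfl fun x hx => ?_
          rw [mul_sum]
          refine sum_congr rfl fun x' _ => ?_
          rw [M.sum_transport_mul_transport (mem_filter.1 hx).2 hlr.symm]

theorem sameOp_slide (M : ColourWeights C K) (n k : ℕ) (s : Bool) (hn : 1 ≤ n) :
    M.SameOp n [⟨1, .vertex 0 k⟩]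
      (⟨0, .vertex 0 k⟩ :: (List.range k).reverse.map fun i => ⟨i, .crossing s⟩) := by
  intro f x hx hl
  match x, hx with
  | [], _ | [_], _ => simp at hl; try omega
  | l :: r :: z, hx =>
    have hlr := (List.isChain_cons_cons.1 hx).1
    change M.vertexOp 0 k (fun u => f (l :: u)) (r :: z) = M.vertexOp 0 k (M.wordOp _ f) (l :: r :: z)
    rw [vertexOp_cons, vertexOp_cons, List.drop_zero, List.drop_zero, M.pathSum_slide s k l l r hlr,
      sum_filter, sum_eq_single r]
    · simp [transport, hlr.symm]
    · intro x _ hx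
      simp [transport, hx]
    · simp

theorem sameOp_of_move (M : ColourWeights C K) {n m m' : ℕ} {w w' : List Layer}
    (h : PlanarMove w w' ∨ ReidemeisterMove w w') (hw : IsDiagram n w m)
    (hw' : IsDiagram n w' m') : M.SameOp n w w' := by
  have shift (a k : ℕ) (hn : a + k ≤ n) {v v' : List Layer}
      (h : ∀ n, k ≤ n → M.SameOp n v v') :
      M.SameOp n (v.map fun l => ⟨a + l.left, l.piece⟩) (v'.map fun l => ⟨a + l.left, l.piece⟩) := by
    obtain ⟨b, rfl⟩ := Nat.exists_eq_add_of_le' (le_trans (Nat.le_add_right a k) hn)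
    exact (h b (by omega)).shift_iterate a
  rcases h with h | h
  · cases h with
    | exchange a c p q =>
      simpa [add_assoc] using shift a p.top (isDiagram_cons_iff.1 hw).1
        fun n hn => M.sameOp_exchange c p q hn
    | zigzag_left a =>
      simpa using shift a 1 (isDiagram_cons_iff.1 hw).1 M.sameOp_zigzag_left
    | zigzag_right a =>
      refine shift a 1 ?_ M.sameOp_zigzag_right
      simp only [isDiagram_cons_iff, Piece.top, Piece.bot] at hw
      omega
    | turn_crossing a s =>
      exact shift a 2 (isDiagram_cons_iff.1 hw').1 fun n => M.sameOp_turn_crossing n s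
    | turn_vertex_left a p q =>
      exact shift a p (isDiagram_cons_iff.1 hw').1 fun n _ => M.sameOp_turn_vertex_left n p q
    | turn_vertex_right a p q =>
      exact shift a p (isDiagram_cons_iff.1 hw').1 fun n => M.sameOp_turn_vertex_right n p q
  · cases h with
    | curl a s =>
      refine shift a 1 ?_ fun n => M.sameOp_curl n s
      simp only [isDiagram_cons_iff, Piece.top, Piece.bot] at hw
      omega
    | cancel a s =>
      exact shift a 2 (isDiagram_cons_iff.1 hw).1 fun n => M.sameOp_cancel n s
    | braid a s =>
      refine shift a 3 ?_ fun n => M.sameOp_braid n s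
      simp only [isDiagram_cons_iff, Piece.top, Piece.bot] at hw
      omega
    | slide a k s =>
      simpa [Function.comp_def] using shift a 1 (isDiagram_cons_iff.1 hw).1
        fun n => M.sameOp_slide n k s

/-- The action of a diagram is an isotopy invariant. -/
theorem wordOp_eq_of_isotopyStep (M : ColourWeights C K) {n m : ℕ} {D D' : Diagram n m}
    (h : IsotopyStep D D') (f : List C → K) {x : List C} (hx : x.IsChain (· ≠ ·))
    (hl : x.length = n + 1) : M.wordOp D.1 f x = M.wordOp D'.1 f x := by
  obtain ⟨u, w, w', v, hm, h₁, h₂⟩ := h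
  obtain ⟨k₂, h₃, hv⟩ := isDiagram_append_iff.1 (h₁ ▸ D.2)
  obtain ⟨k₁, hu, hw⟩ := isDiagram_append_iff.1 h₃
  obtain ⟨k₂', h₃', hv'⟩ := isDiagram_append_iff.1 (h₂ ▸ D'.2)
  obtain ⟨k₁', hu', hw'⟩ := isDiagram_append_iff.1 h₃'
  obtain rfl := hu.unique hu'
  rw [h₁, h₂]
  simp only [wordOp_append]
  exact M.wordOp_congr hu hx hl fun y hy hyl => M.sameOp_of_move hm hw hw' _ y hy hyl

/-! ### The skein relations in the colouring model -/

theorem wordOp_offset (M : ColourWeights C K) (w : List Layer) (f : List C → K) (u z : List C) :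
    M.wordOp (w.map fun l => ⟨u.length + l.left, l.piece⟩) f (u ++ z) =
      M.wordOp w (fun y => f (u ++ y)) z := by
  induction w generalizing z with
  | nil => rfl
  | cons l w ih =>
    change M.layerOp _ _ (M.wordOp (w.map fun l => ⟨u.length + l.left, l.piece⟩) f) (u ++ z) = _
    rw [layerOp_append, funext ih]
    rfl

theorem crossing_relation (M : ColourWeights C K) (f : List C → K) (l t r : C) (z : List C)
    (hx : (l :: t :: r :: z).IsChain (· ≠ ·)) :
    M.wordOp [⟨0, .crossing false⟩] f (l :: t :: r :: z) = M.B * f (l :: t :: r :: z)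
      + M.B' * M.wordOp [⟨0, .cup⟩, ⟨0, .cap⟩] f (l :: t :: r :: z)
      - M.δ * M.wordOp [⟨0, .vertex 2 2⟩] f (l :: t :: r :: z) := by
  simp only [List.isChain_cons_cons] at hx
  have h₁ : M.wordOp [⟨0, .crossing false⟩] f (l :: t :: r :: z) =
      ∑ b with b ≠ l ∧ b ≠ r, M.crossingWeight l t b r * f (l :: b :: r :: z) := rfl
  have h₂ : M.wordOp [⟨0, .cup⟩, ⟨0, .cap⟩] f (l :: t :: r :: z) =
      if r = l then ∑ m with m ≠ r, f (r :: m :: r :: z) else 0 := by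
    change M.pieceOp .cup (M.pieceOp .cap f) (l :: t :: r :: z) = _
    rw [cupOp_cons, capOp_cons, mul_inv_cancel_left₀ M.ne_zero]
  have h₃ : M.δ * M.wordOp [⟨0, .vertex 2 2⟩] f (l :: t :: r :: z) =
      ∑ b with b ≠ l ∧ b ≠ r, f (l :: b :: r :: z) := by
    change M.δ * M.vertexOp 2 2 f (l :: t :: r :: z) = _
    rw [vertexOp_cons, ← mul_assoc]
    norm_num [pathSum_two, M.ne_zero]
  have h₄ : ∑ b with b ≠ l ∧ b ≠ r, (if t = b then M.B else 0) * f (l :: b :: r :: z) =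
      M.B * f (l :: t :: r :: z) := by
    rw [sum_filter, sum_eq_single t]
    · simp [hx.1.symm, hx.2.1]
    · intro b _ hb
      simp [hb.symm]
    · simp
  rw [h₁, h₂, h₃, ← h₄]
  simp only [crossingWeight, sub_mul, add_mul, one_mul, sum_sub_distrib, sum_add_distrib]
  congr 2
  by_cases h : l = r
  · subst h
    simp [mul_sum]
  · simp [h, Ne.symm h]

theorem edge_relation (M : ColourWeights C K) (p q : ℕ) (f : List C → K) (x : List C)
    (hx : p < x.length) :
    M.wordOp [⟨0, .vertex p 1⟩, ⟨0, .vertex 1 q⟩] f x = M.wordOp [⟨0, .vertex p q⟩] f x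
      - M.δ⁻¹ * M.wordOp [⟨0, .vertex p 0⟩, ⟨0, .vertex 0 q⟩] f x := by
  match x with
  | [] => simp at hx
  | l :: x =>
    change M.vertexOp p 1 (M.vertexOp 1 q f) (l :: x) = M.vertexOp p q f (l :: x)
      - M.δ⁻¹ * M.vertexOp p 0 (M.vertexOp 0 q f) (l :: x)
    simp only [vertexOp_cons]
    obtain ⟨r, z, h⟩ : ∃ r z, (l :: x).drop p = r :: z := by
      cases h : (l :: x).drop p with
      | nil => rw [List.drop_eq_nil_iff] at h; omega
      | cons r z => exact ⟨r, z, rfl⟩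
    rw [h, pathSum_one, pathSum_zero, vertexOp_cons, vertexOp_cons]
    by_cases hr : r = l
    · subst hr
      simp [M.ne_zero]
    · simp [hr]

theorem card_filter_ne_eq (M : ColourWeights C K) (c : C) : (#{m | m ≠ c} : K) = M.δ ^ 2 - 1 := by
  rw [card_filter_ne, M.sq_eq, M.card_eq]
  ring

theorem loop_relation (M : ColourWeights C K) (p : ℕ) (f : List C → K) (x : List C)
    (hx : p < x.length) :
    M.wordOp [⟨0, .vertex p 2⟩, ⟨0, .cup⟩] f x =
      (M.δ - M.δ⁻¹) * M.wordOp [⟨0, .vertex p 0⟩] f x := by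
  match x with
  | [] => simp at hx
  | l :: x =>
    change M.vertexOp p 2 (M.pieceOp .cup f) (l :: x) =
      (M.δ - M.δ⁻¹) * M.vertexOp p 0 f (l :: x)
    simp only [vertexOp_cons]
    obtain ⟨r, z, h⟩ : ∃ r z, (l :: x).drop p = r :: z := by
      cases h : (l :: x).drop p with
      | nil => rw [List.drop_eq_nil_iff] at h; omega
      | cons r z => exact ⟨r, z, rfl⟩
    rw [h, pathSum_two, pathSum_zero]
    simp only [cupOp_cons]
    by_cases hr : r = l
    · subst hr
      have := M.ne_zero
      simp only [and_self, if_true, sum_const, nsmul_eq_mul, M.card_filter_ne_eq]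
      norm_num
      field_simp
    · simp [hr]

theorem circle_relation (M : ColourWeights C K) (f : List C → K) (l : C) (z : List C) :
    M.wordOp [⟨0, .cap⟩, ⟨0, .cup⟩] f (l :: z) = (M.δ ^ 2 - 1) * f (l :: z) := by
  change M.pieceOp .cap (M.pieceOp .cup f) (l :: z) = _
  have := M.ne_zero
  simp only [capOp_cons, cupOp_cons, if_true, sum_const, nsmul_eq_mul, M.card_filter_ne_eq]
  field_simp

theorem bivalent_relation (M : ColourWeights C K) (f : List C → K) (l r : C) (z : List C)
    (h : l ≠ r) : M.wordOp [⟨0, .vertex 1 1⟩] f (l :: r :: z) = f (l :: r :: z) := by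
  change M.vertexOp 1 1 f (l :: r :: z) = _
  rw [vertexOp_cons]
  simp [pathSum_one, h.symm]

theorem isolated_relation (M : ColourWeights C K) (f : List C → K) (l : C) (z : List C) :
    M.wordOp [⟨0, .vertex 0 0⟩] f (l :: z) = M.δ * f (l :: z) := by
  change M.vertexOp 0 0 f (l :: z) = _
  rw [vertexOp_cons]
  simp [pathSum_zero]

/-- Linear relations between words hold inside every diagram. -/
theorem wordOp_context (M : ColourWeights C K) {ι : Type} [Fintype ι] (w : List Layer)
    (W : ι → List Layer) (k : ι → K) (a N : ℕ)
    (h : ∀ (g : List C → K) (z : List C), z.IsChain (· ≠ ·) → N ≤ z.length →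
      M.wordOp w g z = ∑ i, k i * M.wordOp (W i) g z)
    {n m : ℕ} {u : List Layer} (v : List Layer) (hu : IsDiagram n u m) (hN : a + N ≤ m + 1)
    (f : List C → K) {x : List C} (hx : x.IsChain (· ≠ ·)) (hl : x.length = n + 1) :
    M.wordOp (u ++ (w.map fun l => ⟨a + l.left, l.piece⟩) ++ v) f x =
      ∑ i, k i * M.wordOp (u ++ ((W i).map fun l => ⟨a + l.left, l.piece⟩) ++ v) f x := by
  have e : ∑ i, k i * M.wordOp (u ++ ((W i).map fun l => ⟨a + l.left, l.piece⟩) ++ v) f x =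
      M.wordOp u (∑ i, k i • M.wordOp ((W i).map fun l => ⟨a + l.left, l.piece⟩)
        (M.wordOp v f)) x := by
    rw [map_sum, Finset.sum_apply]
    simp only [map_smul, wordOp_append]
    rfl
  rw [e, wordOp_append, wordOp_append]
  refine M.wordOp_congr hu hx hl fun y hy hyl => ?_
  obtain ⟨y₁, y₂, rfl, rfl⟩ : ∃ y₁ y₂, y = y₁ ++ y₂ ∧ y₁.length = a :=
    ⟨y.take a, y.drop a, by simp, by simp; omega⟩
  rw [wordOp_offset, h _ _ hy.right_of_append (by rw [List.length_append] at hyl; omega),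
    Finset.sum_apply]
  refine sum_congr rfl fun i _ => ?_
  rw [Pi.smul_apply, wordOp_offset]
  rfl

/-- The evaluation of ribbon graphs in the colouring model, with the colours `x` at the upper line
and the function `f` of the colours at the lower line, extended to the free module along a
homomorphism from the coefficient ring. -/
theorem exists_evaluation (M : ColourWeights C K) (φ : SkeinRing →+* K) (n : ℕ) (f : List C → K)
    {x : List C} (hx : x.IsChain (· ≠ ·)) (hl : x.length = n + 1) :
    ∃ E : MonoidAlgebra SkeinRing (RibbonGraph n) →+ K,
      (∀ r y, E (r • y) = φ r * E y) ∧ ∀ D : Diagram n n, E D.elt = M.wordOp D.1 f x := by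
  let _ : Module SkeinRing K := Module.compHom K φ
  let val : RibbonGraph n → K := Quot.lift (fun D => M.wordOp D.1 f x)
    fun D D' h => M.wordOp_eq_of_isotopyStep h f hx hl
  let E : MonoidAlgebra SkeinRing (RibbonGraph n) →ₗ[SkeinRing] K :=
    Finsupp.linearCombination SkeinRing val ∘ₗ
      (MonoidAlgebra.coeffLinearEquiv SkeinRing).toLinearMap
  refine ⟨E.toAddMonoidHom, fun r y => E.map_smul r y, fun D => ?_⟩
  change Finsupp.linearCombination SkeinRing val (Finsupp.single (RibbonGraph.mk D) 1) = _
  rw [Finsupp.linearCombination_single, one_smul]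
  rfl

theorem evaluation_yamadaRelator (M : ColourWeights C K) {φ : SkeinRing →+* K}
    (hB : φ (Apow 4) = M.B) (hB' : φ (Apow (-4)) = M.B') (hd : φ d = M.δ) {n : ℕ} {f : List C → K}
    {x : List C} (hx : x.IsChain (· ≠ ·)) (hl : x.length = n + 1)
    {E : MonoidAlgebra SkeinRing (RibbonGraph n) →+ K} (hE : ∀ r y, E (r • y) = φ r * E y)
    (hE' : ∀ D : Diagram n n, E D.elt = M.wordOp D.1 f x)
    {y : MonoidAlgebra SkeinRing (RibbonGraph n)} (hy : YamadaRelator n y) : E y = 0 := by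
  have hdInv : φ dInv = M.δ⁻¹ := by
    refine eq_inv_of_mul_eq_one_right ?_
    rw [← hd, ← map_mul]
    exact (congrArg φ (IsLocalization.Away.mul_invSelf laurentD)).trans (map_one φ)
  have typing {u w v : List Layer} (D : Diagram n n) (h : D.1 = u ++ w ++ v) :
      ∃ m m', IsDiagram n u m ∧ IsDiagram m w m' := by
    obtain ⟨m', h', -⟩ := isDiagram_append_iff.1 (h ▸ D.2)
    obtain ⟨m, hu, hw⟩ := isDiagram_append_iff.1 h'
    exact ⟨m, m', hu, hw⟩
  cases hy with
  | crossing u v a D D₀ D₁ D₂ h h₀ h₁ h₂ =>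
    obtain ⟨m, m', hu, hw⟩ := typing D h
    simp only [isDiagram_cons_iff, Piece.top] at hw
    have key := M.wordOp_context [⟨0, .crossing false⟩]
      ![[], [⟨0, .cup⟩, ⟨0, .cap⟩], [⟨0, .vertex 2 2⟩]] ![M.B, M.B', -M.δ] a 3
      (fun g z hz hzl => by
        match z, hz with
        | [], _ | [_], _ | [_, _], _ => simp at hzl
        | l :: t :: r :: z, hz =>
          rw [M.crossing_relation g l t r z hz]
          simp [Fin.sum_univ_three, wordOp]
          ring) v hu (by omega) f hx hl
    simp only [Fin.sum_univ_three, Matrix.cons_val_zero, Matrix.cons_val_one, Matrix.cons_val,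
      List.map_cons, List.map_nil, add_zero, List.append_nil] at key
    simp only [map_sub, map_add, hE, hE', h, h₀, h₁, h₂, hB, hB', hd, key]
    ring
  | edge u v a p q D D₀ D₁ h h₀ h₁ =>
    obtain ⟨m, m', hu, hw⟩ := typing D h
    simp only [isDiagram_cons_iff, Piece.top] at hw
    have key := M.wordOp_context [⟨0, .vertex p 1⟩, ⟨0, .vertex 1 q⟩]
      ![[⟨0, .vertex p q⟩], [⟨0, .vertex p 0⟩, ⟨0, .vertex 0 q⟩]] ![1, -M.δ⁻¹] a (p + 1)
      (fun g z hz hzl => by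
        rw [M.edge_relation p q g z hzl]
        simp [Fin.sum_univ_two]
        ring) v hu (by omega) f hx hl
    simp only [Fin.sum_univ_two, Matrix.cons_val_zero, Matrix.cons_val_one,
      List.map_cons, List.map_nil, add_zero] at key
    simp only [map_sub, hE, hE', h, h₀, h₁, hdInv, key]
    ring
  | loop u v a p D D₀ h h₀ =>
    obtain ⟨m, m', hu, hw⟩ := typing D h
    simp only [isDiagram_cons_iff, Piece.top] at hw
    have key := M.wordOp_context [⟨0, .vertex p 2⟩, ⟨0, .cup⟩]
      ![[⟨0, .vertex p 0⟩]] ![M.δ - M.δ⁻¹] a (p + 1)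
      (fun g z hz hzl => by
        rw [M.loop_relation p g z hzl]
        simp) v hu (by omega) f hx hl
    simp only [Fin.sum_univ_one, Matrix.cons_val_fin_one,
      List.map_cons, List.map_nil, add_zero] at key
    rw [map_sub, hE, hE', hE', h, h₀, map_sub, hdInv, hd, key, sub_self]
  | circle u v a D D₀ h h₀ =>
    obtain ⟨m, m', hu, hw⟩ := typing D h
    simp only [isDiagram_cons_iff, Piece.top] at hw
    have key := M.wordOp_context [⟨0, .cap⟩, ⟨0, .cup⟩] ![[]] ![M.δ ^ 2 - 1] a 1
      (fun g z hz hzl => by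
        match z with
        | [] => simp at hzl
        | l :: z =>
          rw [M.circle_relation g l z]
          simp [wordOp]) v hu (by omega) f hx hl
    simp only [Fin.sum_univ_one, Matrix.cons_val_fin_one,
      List.map_cons, List.map_nil, add_zero, List.append_nil] at key
    rw [map_sub, hE, hE', hE', h, h₀, map_sub, map_pow, map_one, hd, key, sub_self]
  | bivalent u v a D D₀ h h₀ =>
    obtain ⟨m, m', hu, hw⟩ := typing D h
    simp only [isDiagram_cons_iff, Piece.top] at hw
    have key := M.wordOp_context [⟨0, .vertex 1 1⟩] ![[]] ![1] a 2
      (fun g z hz hzl => by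
        match z, hz with
        | [], _ | [_], _ => simp at hzl
        | l :: r :: z, hz =>
          rw [M.bivalent_relation g l r z (List.isChain_cons_cons.1 hz).1]
          simp [wordOp]) v hu (by omega) f hx hl
    simp only [Fin.sum_univ_one, Matrix.cons_val_fin_one,
      List.map_cons, List.map_nil, add_zero, List.append_nil, one_mul] at key
    rw [map_sub, hE', hE', h, h₀, key, sub_self]
  | isolated u v a D D₀ h h₀ =>
    obtain ⟨m, m', hu, hw⟩ := typing D h
    simp only [isDiagram_cons_iff, Piece.top] at hw
    have key := M.wordOp_context [⟨0, .vertex 0 0⟩] ![[]] ![M.δ] a 1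
      (fun g z hz hzl => by
        match z with
        | [] => simp at hzl
        | l :: z =>
          rw [M.isolated_relation g l z]
          simp [wordOp]) v hu (by omega) f hx hl
    simp only [Fin.sum_univ_one, Matrix.cons_val_fin_one,
      List.map_cons, List.map_nil, add_zero, List.append_nil] at key
    rw [map_sub, hE, hE', hE', h, h₀, hd, key, sub_self]

theorem evaluation_eq_zero (M : ColourWeights C K) {φ : SkeinRing →+* K}
    (hB : φ (Apow 4) = M.B) (hB' : φ (Apow (-4)) = M.B') (hd : φ d = M.δ) {n : ℕ} {f : List C → K}
    {x : List C} (hx : x.IsChain (· ≠ ·)) (hl : x.length = n + 1)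
    {E : MonoidAlgebra SkeinRing (RibbonGraph n) →+ K} (hE : ∀ r y, E (r • y) = φ r * E y)
    (hE' : ∀ D : Diagram n n, E D.elt = M.wordOp D.1 f x)
    {y : MonoidAlgebra SkeinRing (RibbonGraph n)} (hy : y ∈ yamadaSubmodule n) : E y = 0 := by
  induction hy using Submodule.span_induction with
  | mem y h => exact M.evaluation_yamadaRelator hB hB' hd hx hl hE hE' h
  | zero => exact map_zero E
  | add y z _ _ h₁ h₂ => rw [map_add, h₁, h₂, add_zero]
  | smul c y _ h => rw [hE, h, mul_zero]

/-- The coefficients of a linear relation between the three generators vanish after every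
specialization to which a colouring model with at least four colours belongs. -/
theorem map_eq_zero_of_relation (M : ColourWeights C K) {φ : SkeinRing →+* K}
    (hB : φ (Apow 4) = M.B) (hB' : φ (Apow (-4)) = M.B') (hd : φ d = M.δ)
    (hC : 4 ≤ Fintype.card C) {g₀ g₁ g₂ : SkeinRing}
    (h : g₀ • (1 : YamadaAlgebra 2) + g₁ • diagramV.skein + g₂ • diagramX.skein = 0) :
    φ g₀ = 0 ∧ φ g₁ = 0 ∧ φ g₂ = 0 := by
  obtain ⟨D, hD, hD₁⟩ : ∃ D : Diagram 2 2, D.1 = [] ∧ D.skein = (1 : YamadaAlgebra 2) :=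
    ⟨⟨[], .nil 2⟩, rfl, rfl⟩
  rw [← hD₁] at h
  have hmem : g₀ • D.elt + g₁ • diagramV.elt + g₂ • diagramX.elt ∈
      yamadaSubmodule 2 := by
    have h' : Ideal.Quotient.mkₐ SkeinRing (yamadaIdeal 2)
        (g₀ • D.elt + g₁ • diagramV.elt + g₂ • diagramX.elt) = 0 := by
      rw [map_add, map_add, map_smul, map_smul, map_smul]
      exact h
    exact Ideal.Quotient.eq_zero_iff_mem.1 h'
  -- The matrix entry of the relation for the colours `l, t, r` above and `l, b, r` below.
  have key (l t b r : C) (hlt : l ≠ t) (htr : t ≠ r) (hlb : b ≠ l) (hbr : b ≠ r) :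
      φ g₀ * (if t = b then 1 else 0) + φ g₁ * (if r = l then 1 else 0) + φ g₂ * M.δ⁻¹ = 0 := by
    let f : List C → K := fun y => if y = [l, b, r] then 1 else 0
    have hx : [l, t, r].IsChain (· ≠ ·) := by simp [hlt, htr]
    obtain ⟨E, hE, hE'⟩ := M.exists_evaluation φ 2 f hx rfl
    have h₀ := M.evaluation_eq_zero hB hB' hd hx rfl hE hE' hmem
    have hV : M.wordOp diagramV.1 f [l, t, r] = if r = l then 1 else 0 := by
      change M.pieceOp .cup (M.pieceOp .cap f) [l, t, r] = _
      rw [cupOp_cons, capOp_cons, mul_inv_cancel_left₀ M.ne_zero, sum_filter, sum_eq_single b]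
      · by_cases hrl : r = l
        · simp [f, hrl, hlb]
        · simp [hrl]
      · intro c _ hc
        simp [f, hc]
      · simp
    have hX : M.wordOp diagramX.1 f [l, t, r] = M.δ⁻¹ := by
      change M.vertexOp 2 2 f [l, t, r] = _
      rw [vertexOp_cons]
      simp only [List.drop_succ_cons, List.drop_zero, pathSum_two]
      rw [sum_filter, sum_eq_single b]
      · norm_num [f, hlb, hbr]
      · intro c _ hc
        simp [f, hc]
      · simp
    have h₁ : M.wordOp [] f [l, t, r] = if t = b then 1 else 0 := by
      simp [wordOp, f]
    rwa [map_add, map_add, hE, hE, hE, hE', hE', hE', hD, h₁, hV, hX] at h₀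
  obtain ⟨e⟩ : Nonempty (Fin 4 ↪ C) :=
    Function.Embedding.nonempty_of_card_le (by simpa using hC)
  have ne {i j : Fin 4} (h : i ≠ j) : e i ≠ e j := e.injective.ne h
  have h₂ : φ g₂ = 0 := by
    have := key (e 0) (e 1) (e 2) (e 3) (ne (by decide)) (ne (by decide)) (ne (by decide))
      (ne (by decide))
    simpa [M.ne_zero] using this
  have h₀ : φ g₀ = 0 := by
    have := key (e 0) (e 1) (e 1) (e 3) (ne (by decide)) (ne (by decide)) (ne (by decide))
      (ne (by decide))
    simpa [h₂] using this
  have h₁ : φ g₁ = 0 := by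
    have := key (e 0) (e 1) (e 2) (e 0) (ne (by decide)) (ne (by decide)) (ne (by decide))
      (ne (by decide))
    simpa [h₂] using this
  exact ⟨h₀, h₁, h₂⟩

end ColourWeights
/-! ### Specializations of the coefficient ring -/

/-- For every number `N ≥ 5` of colours there is a real value of `A` with `d² = N`. -/
theorem exists_real_parameter (N : ℕ) (hN : 5 ≤ N) :
    ∃ A : ℝ, 0 < A ∧ (N : ℝ) = A ^ 4 + 2 + (A ^ 4)⁻¹ := by
  have hs : (3 : ℝ) ≤ N - 2 := by
    have : (5 : ℝ) ≤ N := by exact_mod_cast hN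
    linarith
  have hr : √(((N : ℝ) - 2) ^ 2 - 4) ^ 2 = ((N : ℝ) - 2) ^ 2 - 4 :=
    Real.sq_sqrt (by nlinarith)
  set r := √(((N : ℝ) - 2) ^ 2 - 4)
  have hr0 : 0 ≤ r := Real.sqrt_nonneg _
  -- `A⁴` is a root of `x² - (N - 2) x + 1`.
  have hb : 0 < ((N : ℝ) - 2 + r) / 2 := by linarith
  refine ⟨√√(((N : ℝ) - 2 + r) / 2), Real.sqrt_pos.2 (Real.sqrt_pos.2 hb), ?_⟩
  have e : √√(((N : ℝ) - 2 + r) / 2) ^ 4 = ((N : ℝ) - 2 + r) / 2 := by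
    rw [show 4 = 2 * 2 from rfl, pow_mul, Real.sq_sqrt (Real.sqrt_nonneg _), Real.sq_sqrt hb.le]
  rw [e]
  have hb' : ((N : ℝ) - 2 + r) ≠ 0 := by linarith
  field_simp
  linear_combination (-1 : ℝ) * hr

/-- The specialization of Laurent polynomials at a nonzero real number. -/
noncomputable def laurentEval (A : ℝ) (hA : A ≠ 0) : LaurentPolynomial ℤ →+* ℝ :=
  LaurentPolynomial.eval₂ (Int.castRingHom ℝ) (Units.mk0 A hA)

theorem laurentEval_T (A : ℝ) (hA : A ≠ 0) (k : ℤ) :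
    laurentEval A hA (LaurentPolynomial.T k) = A ^ k := by
  rw [laurentEval, LaurentPolynomial.eval₂_T]
  simp

theorem laurentEval_laurentD (A : ℝ) (hA : A ≠ 0) :
    laurentEval A hA laurentD = -A ^ 2 - (A ^ 2)⁻¹ := by
  rw [laurentD, map_sub, map_neg, laurentEval_T, laurentEval_T]
  norm_cast

/-- The specialization of the coefficient ring at a positive real number. -/
noncomputable def skeinEval (A : ℝ) (hA : 0 < A) : SkeinRing →+* ℝ :=
  IsLocalization.Away.lift laurentD (g := laurentEval A hA.ne') <| by
    rw [laurentEval_laurentD, isUnit_iff_ne_zero]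
    have : 0 < A ^ 2 + (A ^ 2)⁻¹ := by positivity
    linarith

theorem skeinEval_algebraMap (A : ℝ) (hA : 0 < A) (p : LaurentPolynomial ℤ) :
    skeinEval A hA (algebraMap _ _ p) = laurentEval A hA.ne' p :=
  IsLocalization.Away.lift_eq _ _ _

/-- A Laurent polynomial is determined by its values at infinitely many numbers. -/
theorem laurent_eq_zero_of_infinite {S : Set ℝ} (hS : S.Infinite) {p : LaurentPolynomial ℤ}
    (h : ∀ A ∈ S, ∃ hA : A ≠ 0, laurentEval A hA p = 0) : p = 0 := by
  obtain ⟨n, q, hq⟩ := p.exists_T_pow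
  have hq0 : q.map (Int.castRingHom ℝ) = 0 := by
    refine Polynomial.eq_zero_of_infinite_isRoot _ (hS.mono fun A hA => ?_)
    obtain ⟨hA0, hp⟩ := h A hA
    have := congrArg (laurentEval A hA0) hq
    rw [map_mul, hp, zero_mul, laurentEval, LaurentPolynomial.eval₂_toLaurent] at this
    change Polynomial.eval A (q.map (Int.castRingHom ℝ)) = 0
    rw [Polynomial.eval_map]
    exact this
  rw [Polynomial.map_eq_zero_iff (RingHom.injective_int _)] at hq0
  rw [hq0, map_zero] at hq
  exact (LaurentPolynomial.isUnit_T n).mul_left_eq_zero.1 hq.symm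

/-- An element of the coefficient ring vanishes if it does so whenever `d²` is a large integer. -/
theorem skeinRing_eq_zero {g : SkeinRing}
    (h : ∀ (N : ℕ) (A : ℝ) (hA : 0 < A), 5 ≤ N → (N : ℝ) = A ^ 4 + 2 + (A ^ 4)⁻¹ →
      skeinEval A hA g = 0) : g = 0 := by
  obtain ⟨⟨p, s⟩, hp⟩ := IsLocalization.surj (Submonoid.powers laurentD) g
  choose! A hA hN using exists_real_parameter
  have hinj : Set.InjOn A (Set.Ici 5) := by
    intro N hN₁ N' hN₂ e
    have := hN N hN₁
    rw [e, ← hN N' hN₂] at this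
    exact_mod_cast this
  have hp0 : p = 0 := by
    refine laurent_eq_zero_of_infinite ((Set.Ici_infinite 5).image hinj) ?_
    rintro _ ⟨N, hN₁, rfl⟩
    refine ⟨(hA N hN₁).ne', ?_⟩
    rw [← skeinEval_algebraMap _ (hA N hN₁), ← hp, map_mul, h N _ _ hN₁ (hN N hN₁), zero_mul]
  rw [hp0, map_zero] at hp
  exact (IsLocalization.map_units SkeinRing s).mul_left_eq_zero.1 hp

/-- The colouring model with `N` colours for a real value of `A`. -/
noncomputable def realColourWeights (N : ℕ) (A : ℝ) (hA : 0 < A)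
    (h : (N : ℝ) = A ^ 4 + 2 + (A ^ 4)⁻¹) : ColourWeights (Fin N) ℝ where
  B := A ^ 4
  B' := (A ^ 4)⁻¹
  δ := -A ^ 2 - (A ^ 2)⁻¹
  mul_eq_one := mul_inv_cancel₀ (by positivity)
  card_eq := by rw [Fintype.card_fin, h]
  sq_eq := by
    rw [Fintype.card_fin, h]
    field_simp
    ring
  ne_zero := by
    have : 0 < A ^ 2 + (A ^ 2)⁻¹ := by positivity
    linarith

theorem linearIndependent_generators :
    LinearIndependent SkeinRing ![(1 : YamadaAlgebra 2), diagramV.skein, diagramX.skein] := by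
  rw [Fintype.linearIndependent_iff]
  intro g hg
  simp only [Fin.sum_univ_three, Matrix.cons_val_zero, Matrix.cons_val_one, Matrix.cons_val] at hg
  have key (N : ℕ) (A : ℝ) (hA : 0 < A) (hN : 5 ≤ N) (h : (N : ℝ) = A ^ 4 + 2 + (A ^ 4)⁻¹) :=
    (realColourWeights N A hA h).map_eq_zero_of_relation (φ := skeinEval A hA)
      ((skeinEval_algebraMap _ _ _).trans ((laurentEval_T _ _ _).trans (by norm_cast)))
      ((skeinEval_algebraMap _ _ _).trans ((laurentEval_T _ _ _).trans (by norm_cast)))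
      ((skeinEval_algebraMap _ _ _).trans (laurentEval_laurentD _ _))
      (by rw [Fintype.card_fin]; omega) hg
  intro i
  refine skeinRing_eq_zero fun N A hA hN h => ?_
  have := key N A hA hN h
  fin_cases i
  exacts [this.1, this.2.1, this.2.2]

theorem theorem1p1 :
    LinearIndependent SkeinRing
      ![(1 : YamadaAlgebra 2), diagramV.skein, diagramX.skein] ∧
    Submodule.span SkeinRing {(1 : YamadaAlgebra 2), diagramV.skein, diagramX.skein} = ⊤ ∧
    Algebra.adjoin SkeinRing {(1 : YamadaAlgebra 2), diagramV.skein, diagramX.skein} = ⊤ := by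
  refine ⟨linearIndependent_generators, span_generators_eq_top, ?_⟩
  rw [← Algebra.toSubmodule_eq_top, eq_top_iff, ← span_generators_eq_top]
  exact Algebra.span_le_adjoin _ _
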